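/- Let $(M;\varphi,\xi,\eta,g)$ be an almost contact pseudo-metric $3$-manifold: $M$ is a smooth (Hausdorff, paracompact) $3$-manifold, $\varphi$ is a smooth endomorphism field of $TM$, $\xi$ a smooth vector field, $\eta$ a smooth $1$-form and $g$ a pseudo-Riemannian metric with $$\varphi^2=-\mathrm{id}+\eta\otimes\xi,\quad \eta(\xi)=1,\quad g(\varphi X,\varphi Y)=g(X,Y)-\varepsilon\,\eta(X)\eta(Y),$$ where $\varepsilon=g(\xi,\xi)=1$ if $\xi$ is spacelike and $\varepsilon=-1$ if $\xi$ is timelike. Let $\nabla$ be the Levi-Civita connection of $g$ and put $2\alpha=\operatorname{trace}\{X\mapsto\varphi\nabla_X\xi\}$, $2\beta=\operatorname{trace}\{X\mapsto\nabla_X\xi\}$. Suppose that $M$ is quasi-Sasakian, that is, it is normal, $N_\varphi(X,Y)+2\,d\eta(X,Y)\,\xi=0$, where $$N_\varphi(X,Y)=[\varphi X,\varphi Y]-\varphi[\varphi X,Y]+\varphi^2[X,Y]-\varphi[X,\varphi Y],\qquad 2\,d\eta(X,Y)=X\eta(Y)-Y\eta(X)-\eta([X,Y]),$$ and $\beta=0$,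 $\xi(\alpha)=0$. Let $I$ be an open interval, $s_0\in I$, and let $\upsilon:I\to M$ be a non-geodesic Legendre curve: a smooth curve with $g(\upsilon',\upsilon')=1$, $\eta(\upsilon')=0$ and $\kappa=\sqrt{|g(\nabla_{\upsilon'}\upsilon',\nabla_{\upsilon'}\upsilon')|}>0$ on $I$. Assume that $\alpha\neq0$ along $\upsilon$, and write $\alpha(s)$ for $\alpha(\upsilon(s))$ and $\vartheta=g(\nabla_{\upsilon'}\upsilon',\varphi\upsilon')$. Points and spheres are understood infinitesimally along $\upsilon$: a point $c$ is given by its position vectors $c-\upsilon$, a smooth vector field along $\upsilon$ with $(c-\upsilon)(s)\in T_{\upsilon(s)}M$; its derivative is $\nabla_{\upsilon'}c=\upsilon'+\nabla_{\upsilon'}(c-\upsilon)$, and $c$ is *constant* if $\nabla_{\upsilon'}c=0$ on $I$. The curve $\upsilon$ is *spherical* if there are a constant point $c$ and a number $r>0$ such that at each $s\in I$ one has $g(c-\upsilon,c-\upsilon)=r^2$ or $g(c-\upsilon,c-\upsilon)=-r^2$. A vector $v\in T_{\upsilon(s)}M$ is (the position vector of) the *centre of an osculating sphere of $\upsilon$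 at $\upsilon(s)$* if there are a constant point $c$ with $(c-\upsilon)(s)=v$, a number $r\ge0$ and a sign $\pm$ such that the function $\gamma(t)=g(c-\upsilon(t),c-\upsilon(t))\mp r^2$ satisfies $\gamma(s)=\gamma'(s)=\gamma''(s)=\gamma'''(s)=0$. Assume that $\vartheta$ is not a constant function on $I$ if $\xi$ is spacelike, and that if $\xi$ is timelike then $\vartheta$ is neither of the two functions $s\mapsto\vartheta(s_0)\exp\left(\pm\int_{s_0}^s|\alpha(t)|\,dt\right)$ on $I$. Then the following are equivalent: (a) $\upsilon$ is spherical; (b) the centres of the osculating spheres at the points $\upsilon(s)$, $s\in I$, are one and the same constant point, i.e. there is a constant point $c$ such that, for every $s\in I$, $(c-\upsilon)(s)$ is the centre of an osculating sphere of $\upsilon$ at $\upsilon(s)$; (c) $\displaystyle\left(\frac{\vartheta'}{\vartheta^2|\alpha|}\right)'-\frac{\varepsilon|\alpha|}{\vartheta}=0$ on $I$. -/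

import Mathlib

open Bundle
open scoped Manifold ContDiff

noncomputable section

namespace QuasiSasakian

/-- The model space of a 3-manifold. -/
abbrev E3 : Type := EuclideanSpace ℝ (Fin 3)

/-- Vector fields (not necessarily smooth) on a 3-manifold. -/
abbrev VField (M : Type*) [TopologicalSpace M] [ChartedSpace E3 M] : Type _ :=
  ∀ x : M, TangentSpace (𝓡 3) x

/-- A vector field is smooth. -/
def SmoothField {M : Type*} [TopologicalSpace M] [ChartedSpace E3 M] [IsManifold (𝓡 3) ∞ M]
    (X : VField M) : Prop :=
  ContMDiff (𝓡 3) ((𝓡 3).prod 𝓘(ℝ, E3)) ∞ (fun x => TotalSpace.mk' E3 x (X x))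

/-- An almost contact pseudo-metric structure `(φ, ξ, η, g)` on a 3-manifold, where
`ε = g(ξ, ξ)` is `1` if `ξ` is spacelike and `-1` if `ξ` is timelike. -/
structure AlmostContactPseudoMetric (M : Type*) [TopologicalSpace M] [ChartedSpace E3 M]
    [IsManifold (𝓡 3) ∞ M] where
  /-- The causal character of the Reeb vector field. -/
  ε : ℝ
  /-- The structure endomorphism of the tangent bundle. -/
  φ : ∀ x : M, TangentSpace (𝓡 3) x →L[ℝ] TangentSpace (𝓡 3) x
  /-- The Reeb vector field. -/
  ξ : VField M
  /-- The 1-form. -/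
  η : ∀ x : M, TangentSpace (𝓡 3) x →L[ℝ] ℝ
  /-- The pseudo-Riemannian metric. -/
  g : ∀ x : M, TangentSpace (𝓡 3) x →L[ℝ] TangentSpace (𝓡 3) x →L[ℝ] ℝ
  ε_sq : ε ^ 2 = 1
  smooth_φ : ContMDiff (𝓡 3) ((𝓡 3).prod 𝓘(ℝ, E3 →L[ℝ] E3)) ∞
    (fun x => TotalSpace.mk' (E3 →L[ℝ] E3)
      (E := fun x : M => TangentSpace (𝓡 3) x →L[ℝ] TangentSpace (𝓡 3) x) x (φ x))
  smooth_ξ : SmoothField ξ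
  smooth_η : ContMDiff (𝓡 3) ((𝓡 3).prod 𝓘(ℝ, E3 →L[ℝ] ℝ)) ∞
    (fun x => TotalSpace.mk' (E3 →L[ℝ] ℝ)
      (E := fun x : M => TangentSpace (𝓡 3) x →L[ℝ] Trivial M ℝ x) x (η x))
  smooth_g : ContMDiff (𝓡 3) ((𝓡 3).prod 𝓘(ℝ, E3 →L[ℝ] E3 →L[ℝ] ℝ)) ∞
    (fun x => TotalSpace.mk' (E3 →L[ℝ] E3 →L[ℝ] ℝ)
      (E := fun x : M => TangentSpace (𝓡 3) x →L[ℝ] TangentSpace (𝓡 3) x →L[ℝ] Trivial M ℝ x)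
      x (g x))
  g_symm : ∀ (x : M) (v w : TangentSpace (𝓡 3) x), g x v w = g x w v
  g_nondegenerate : ∀ (x : M) (v : TangentSpace (𝓡 3) x), (∀ w, g x v w = 0) → v = 0
  φ_sq : ∀ (x : M) (v : TangentSpace (𝓡 3) x), φ x (φ x v) = -v + η x v • ξ x
  η_ξ : ∀ x : M, η x (ξ x) = 1
  compatible : ∀ (x : M) (v w : TangentSpace (𝓡 3) x),
    g x (φ x v) (φ x w) = g x v w - ε * (η x v * η x w)

/-- An affine connection on the tangent bundle; `D Y x (X x)` is `(∇_X Y)(x)`. -/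
abbrev Connection (M : Type*) [TopologicalSpace M] [ChartedSpace E3 M]
    [IsManifold (𝓡 3) ∞ M] : Type _ :=
  CovariantDerivative (𝓡 3) E3 (fun x : M => TangentSpace (𝓡 3) x)

section Manifold

variable {M : Type*} [TopologicalSpace M] [ChartedSpace E3 M] [IsManifold (𝓡 3) ∞ M]

/-- `D` is the Levi-Civita connection of the metric `g`: the smooth connection that is torsion-free,
`∇_X Y - ∇_Y X = [X, Y]`, and metric, `X g(Y, Z) = g(∇_X Y, Z) + g(Y, ∇_X Z)`. -/
structure IsLeviCivita (S : AlmostContactPseudoMetric M) (D : Connection M) : Prop where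
  smooth : CovariantDerivative.ContMDiffCovariantDerivative D ∞
  torsion_free : ∀ (X Y : VField M) (x : M),
    MDifferentiableAt (𝓡 3) ((𝓡 3).prod 𝓘(ℝ, E3)) (fun y => TotalSpace.mk' E3 y (X y)) x →
    MDifferentiableAt (𝓡 3) ((𝓡 3).prod 𝓘(ℝ, E3)) (fun y => TotalSpace.mk' E3 y (Y y)) x →
    D Y x (X x) - D X x (Y x) = VectorField.mlieBracket (𝓡 3) X Y x
  metric : ∀ (Y Z : VField M) (x : M) (v : TangentSpace (𝓡 3) x),
    MDifferentiableAt (𝓡 3) ((𝓡 3).prod 𝓘(ℝ, E3)) (fun y => TotalSpace.mk' E3 y (Y y)) x →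
    MDifferentiableAt (𝓡 3) ((𝓡 3).prod 𝓘(ℝ, E3)) (fun y => TotalSpace.mk' E3 y (Z y)) x →
    mvfderiv (𝓡 3) (fun y => S.g y (Y y) (Z y)) x v
      = S.g x (D Y x v) (Z x) + S.g x (Y x) (D Z x v)

/-- `2 dη(X, Y) = X(η(Y)) - Y(η(X)) - η([X, Y])`. -/
def twoDEta (S : AlmostContactPseudoMetric M) (X Y : VField M) (x : M) : ℝ :=
  mvfderiv (𝓡 3) (fun y => S.η y (Y y)) x (X x) - mvfderiv (𝓡 3) (fun y => S.η y (X y)) x (Y x)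
    - S.η x (VectorField.mlieBracket (𝓡 3) X Y x)

/-- The Nijenhuis torsion
`N_φ(X, Y) = [φX, φY] - φ[φX, Y] + φ²[X, Y] - φ[X, φY]`. -/
def nijenhuis (S : AlmostContactPseudoMetric M) (X Y : VField M) (x : M) :
    TangentSpace (𝓡 3) x :=
  VectorField.mlieBracket (𝓡 3) (fun y => S.φ y (X y)) (fun y => S.φ y (Y y)) x
    - S.φ x (VectorField.mlieBracket (𝓡 3) (fun y => S.φ y (X y)) Y x)
    + S.φ x (S.φ x (VectorField.mlieBracket (𝓡 3) X Y x))
    - S.φ x (VectorField.mlieBracket (𝓡 3) X (fun y => S.φ y (Y y)) x)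

/-- Normality: `N_φ + 2 dη ⊗ ξ = 0`. -/
def IsNormal (S : AlmostContactPseudoMetric M) : Prop :=
  ∀ X Y : VField M, SmoothField X → SmoothField Y →
    ∀ x : M, nijenhuis S X Y x + twoDEta S X Y x • S.ξ x = 0

/-- The function `α` with `2α = trace (X ↦ φ ∇_X ξ)`. -/
def alpha (S : AlmostContactPseudoMetric M) (D : Connection M) (x : M) : ℝ :=
  (1 / 2) * LinearMap.trace ℝ (TangentSpace (𝓡 3) x)
    ((S.φ x).toLinearMap ∘ₗ (D S.ξ x).toLinearMap)

/-- The function `β` with `2β = trace (X ↦ ∇_X ξ)`. -/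
def beta (S : AlmostContactPseudoMetric M) (D : Connection M) (x : M) : ℝ :=
  (1 / 2) * LinearMap.trace ℝ (TangentSpace (𝓡 3) x) (D S.ξ x).toLinearMap

/-- Quasi-Sasakian: normal, with `β = 0` and `ξ(α) = 0`. -/
structure IsQuasiSasakian (S : AlmostContactPseudoMetric M) (D : Connection M) : Prop where
  normal : IsNormal S
  beta_eq_zero : ∀ x : M, beta S D x = 0
  xi_alpha : ∀ x : M, mvfderiv (𝓡 3) (alpha S D) x (S.ξ x) = 0

/-- Vector fields along a parametrised curve. -/
abbrev FieldAlong (υ : ℝ → M) : Type :=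
  ∀ t : ℝ, TangentSpace (𝓡 3) (υ t)

/-- The velocity `υ'`. -/
def velocity (υ : ℝ → M) : FieldAlong υ := fun t =>
  mfderiv 𝓘(ℝ, ℝ) (𝓡 3) υ t (1 : ℝ)

/-- The covariant derivative `∇_{υ'} V` of a field `V` along `υ`. In the bundle chart `e` at `υ(t)`,
with constant-coefficient extension `W` of `V(t)`, it is `∇_{υ'(t)} W` plus the derivative of the
coefficients of `V`; in coordinates, `(V^k)' + Γ^k_{ij} (υ^i)' V^j`. -/
def covDerivAlong (D : Connection M) (υ : ℝ → M) (V : FieldAlong υ) : FieldAlong υ := fun t =>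
  let e := trivializationAt E3 (fun x : M => TangentSpace (𝓡 3) x) (υ t)
  let W : VField M := FiberBundle.extend E3 (V t)
  D W (υ t) (velocity υ t)
    + e.symm (υ t) (deriv (fun u : ℝ => (e (TotalSpace.mk' E3 (υ u) (V u))).2) t)

/-- The field `V` along `υ` is smooth on the interval `I`. -/
def SmoothAlong (υ : ℝ → M) (I : Set ℝ) (V : FieldAlong υ) : Prop :=
  ContMDiffOn 𝓘(ℝ, ℝ) ((𝓡 3).prod 𝓘(ℝ, E3)) ∞ (fun t : ℝ => TotalSpace.mk' E3 (υ t) (V t)) I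

/-- The acceleration `∇_T T`, where `T = υ'`. -/
def acceleration (D : Connection M) (υ : ℝ → M) : FieldAlong υ :=
  covDerivAlong D υ (velocity υ)

/-- The geodesic curvature `κ = |∇_T T|`. -/
def curvature (S : AlmostContactPseudoMetric M) (D : Connection M) (υ : ℝ → M) (t : ℝ) : ℝ :=
  Real.sqrt |S.g (υ t) (acceleration D υ t) (acceleration D υ t)|

/-- A non-geodesic Legendre curve on `I`: a smooth unit speed curve with `η(υ') = 0` and `κ > 0`. -/
structure IsNonGeodesicLegendre (S : AlmostContactPseudoMetric M) (D : Connection M)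
    (I : Set ℝ) (υ : ℝ → M) : Prop where
  smooth : ContMDiffOn 𝓘(ℝ, ℝ) (𝓡 3) ∞ υ I
  unit_speed : ∀ t ∈ I, S.g (υ t) (velocity υ t) (velocity υ t) = 1
  legendre : ∀ t ∈ I, S.η (υ t) (velocity υ t) = 0
  curvature_pos : ∀ t ∈ I, 0 < curvature S D υ t

/-- The function `ϑ = g(∇_T T, φT)`. -/
def vartheta (S : AlmostContactPseudoMetric M) (D : Connection M) (υ : ℝ → M) (t : ℝ) : ℝ :=
  S.g (υ t) (acceleration D υ t) (S.φ (υ t) (velocity υ t))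

/-- A point `c`, described along `υ` by its position vectors `P(t) = c - υ(t) ∈ T_{υ(t)} M`, is
constant: the derivative `∇_{υ'} c = υ' + ∇_{υ'} (c - υ)` vanishes. -/
structure IsConstantPoint (D : Connection M) (I : Set ℝ) (υ : ℝ → M) (P : FieldAlong υ) :
    Prop where
  smooth : SmoothAlong υ I P
  deriv_eq_zero : ∀ t ∈ I, velocity υ t + covDerivAlong D υ P t = 0

/-- The curve is spherical: it lies on the sphere `S²_±`, consisting of the points with
`g(c - υ, c - υ) = r²` or `g(c - υ, c - υ) = -r²`, of some constant centre `c` and radius `r > 0`. -/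
def IsSpherical (S : AlmostContactPseudoMetric M) (D : Connection M) (I : Set ℝ) (υ : ℝ → M) :
    Prop :=
  ∃ P : FieldAlong υ, IsConstantPoint D I υ P ∧ ∃ r : ℝ, 0 < r ∧
    ∀ t ∈ I, S.g (υ t) (P t) (P t) = r ^ 2 ∨ S.g (υ t) (P t) (P t) = -r ^ 2

/-- `v ∈ T_{υ(s)} M` is the position vector, relative to `υ(s)`, of the centre of an osculating
sphere of `υ` at `υ(s)`: for the constant point `c` with position vector `v` at `s`, the function
`γ(t) = g(c - υ(t), c - υ(t)) ∓ r²` satisfies `γ = γ' = γ'' = γ''' = 0` at `s`. -/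
def IsOsculatingCentre (S : AlmostContactPseudoMetric M) (D : Connection M) (I : Set ℝ)
    (υ : ℝ → M) (s : ℝ) (v : TangentSpace (𝓡 3) (υ s)) : Prop :=
  ∃ P : FieldAlong υ, IsConstantPoint D I υ P ∧ P s = v ∧
    ∃ r δ : ℝ, 0 ≤ r ∧ (δ = 1 ∨ δ = -1) ∧
      ∀ j ≤ 3, iteratedDeriv j (fun t => S.g (υ t) (P t) (P t) - δ * r ^ 2) s = 0

/-- The centres of the osculating spheres at all points of the curve are one constant point. -/
def OsculatingCentresConstant (S : AlmostContactPseudoMetric M) (D : Connection M) (I : Set ℝ)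
    (υ : ℝ → M) : Prop :=
  ∃ C : FieldAlong υ, (∀ s ∈ I, IsOsculatingCentre S D I υ s (C s)) ∧ IsConstantPoint D I υ C

end Manifold

end QuasiSasakian

end

/-!
The curve carries the orthonormal frame `T = υ'`, `N = φT`, `ξ`, and the whole statement is read off
from its structure equations

  `∇_T T = ϑ N`,  `∇_T N = -ϑ T + ε α ξ`,  `∇_T ξ = -α N`

(`acceleration_eq`, `covDerivAlong_φ_velocity`, `covDerivAlong_ξ`). They follow from the metric
property along `υ` (`IsLeviCivita.productRuleAt`) and from `∇_v ξ = -α φ v` for unit vectors `v` in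
the contact plane (`IsLeviCivita.reeb_eq`). The latter is where quasi-Sasakian enters: normality,
tested against `ξ`, makes `ξ` geodesic and makes `∇ξ` commute with `φ` on the contact plane, so
`∇ξ` is there a combination of the identity and `φ`, with coefficients given by the traces `β = 0`
and `α`.

A point `c` with position vector `P = c - υ` is constant iff `∇_T P = -T`. In terms of
`a = g(P, T)`, `b = g(P, N)`, `k = g(P, ξ)` this reads

  `a' = -1 + ϑ b`,  `b' = -ϑ a + ε α k`,  `k' = -α b`,

while `g(P, P)' = -2 a`. If `υ` lies on a sphere about `c`, or if `c` is the centre of all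
osculating spheres, then `a = 0`; hence `b = 1 / ϑ`, `k = -ε ϑ' / (ϑ² α)`, and the last equation is
the differential equation for `ϑ` (`IsConstantPoint.deriv_eq_of_orthogonal`). Conversely a solution
`ϑ` gives the constant point with `a = 0` and these `b`, `k` (`IsNonGeodesicLegendre.isConstantPoint`),
and `g(P, P) = ϑ⁻² + ε (ϑ' / (ϑ² α))²` is constant. It is the square `± r²` of a positive radius
unless it vanishes, which forces `ε = -1` and `ϑ' = ± |α| ϑ`, that is, one of the two excluded
exponentials (`IsNonGeodesicLegendre.exp_of_null`).

Fields along `υ` are handled through the coordinate frame of a bundle chart: additivity, the Leibniz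
rule and `∇_{υ'}(X ∘ υ) = ∇_{υ'} X` (`covDerivAlong_add`, `covDerivAlong_smul`,
`covDerivAlong_comp`) reduce every statement about them to frame fields.
-/

noncomputable section

namespace QuasiSasakian

open Filter Topology

variable {M : Type*} [TopologicalSpace M] [ChartedSpace E3 M] [IsManifold (𝓡 3) ∞ M]

/-! ### Smooth fields along a curve -/

/-- The field `V` along the curve `υ` is smooth at the parameter `t`. Smoothness of `υ` itself at
`t` is part of this condition. -/
def SmoothAlongAt (υ : ℝ → M) (V : FieldAlong υ) (t : ℝ) : Prop :=
  ContMDiffAt 𝓘(ℝ, ℝ) ((𝓡 3).prod 𝓘(ℝ, E3)) ∞ (fun u : ℝ => TotalSpace.mk' E3 (υ u) (V u)) t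

/-- The coordinates at `y` of a tangent vector, in the bundle chart centred at `x`. They are
meaningful only for `y ∈ coordDomain x`. -/
def coord (x y : M) (v : TangentSpace (𝓡 3) y) : E3 :=
  (trivializationAt E3 (fun x : M => TangentSpace (𝓡 3) x) x (TotalSpace.mk' E3 y v)).2

/-- The domain of the bundle chart centred at `x`. -/
def coordDomain (x : M) : Set M :=
  (trivializationAt E3 (fun x : M => TangentSpace (𝓡 3) x) x).baseSet

lemma coordDomain_mem_nhds (x : M) : coordDomain x ∈ 𝓝 x :=
  (trivializationAt E3 (fun x : M => TangentSpace (𝓡 3) x) x).open_baseSet.mem_nhds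
    (FiberBundle.mem_baseSet_trivializationAt' x)

lemma coord_add {x y : M} (hy : y ∈ coordDomain x) (v w : TangentSpace (𝓡 3) y) :
    coord x y (v + w) = coord x y v + coord x y w :=
  ((trivializationAt E3 (fun x : M => TangentSpace (𝓡 3) x) x).linear ℝ hy).1 v w

lemma coord_smul {x y : M} (hy : y ∈ coordDomain x) (c : ℝ) (v : TangentSpace (𝓡 3) y) :
    coord x y (c • v) = c • coord x y v :=
  ((trivializationAt E3 (fun x : M => TangentSpace (𝓡 3) x) x).linear ℝ hy).2 c v

/-- The tangent vector at `y` with given coordinates in the bundle chart centred at `x`; it is `0` for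
`y ∉ coordDomain x`. -/
def ofCoord (x y : M) : E3 →L[ℝ] TangentSpace (𝓡 3) y :=
  (trivializationAt E3 (fun x : M => TangentSpace (𝓡 3) x) x).symmL ℝ y

lemma ofCoord_eq_symm {x y : M} (hy : y ∈ coordDomain x) (w : E3) :
    ofCoord x y w = (trivializationAt E3 (fun x : M => TangentSpace (𝓡 3) x) x).symm y w :=
  (trivializationAt E3 (fun x : M => TangentSpace (𝓡 3) x) x).symmL_apply hy w

lemma ofCoord_coord {x y : M} (hy : y ∈ coordDomain x) (v : TangentSpace (𝓡 3) y) :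
    ofCoord x y (coord x y v) = v := by
  have h := (trivializationAt E3 (fun x : M => TangentSpace (𝓡 3) x) x).symmL_continuousLinearMapAt
    (R := ℝ) hy v
  rwa [Trivialization.continuousLinearMapAt_apply_of_mem _ _ hy] at h

lemma coord_ofCoord {x y : M} (hy : y ∈ coordDomain x) (w : E3) :
    coord x y (ofCoord x y w) = w := by
  have h := (trivializationAt E3 (fun x : M => TangentSpace (𝓡 3) x) x).continuousLinearMapAt_symmL
    (R := ℝ) hy w
  rwa [Trivialization.continuousLinearMapAt_apply_of_mem _ _ hy] at h

lemma contMDiffAt_ofCoord (x : M) {y : M} (hy : y ∈ coordDomain x) (w : E3) :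
    ContMDiffAt (𝓡 3) ((𝓡 3).prod 𝓘(ℝ, E3)) ∞
      (fun z => TotalSpace.mk' E3 z (ofCoord x z w)) y := by
  have h : ContMDiffOn (𝓡 3) ((𝓡 3).prod 𝓘(ℝ, E3)) ∞
      (fun z => TotalSpace.mk' E3 z (ofCoord x z w)) (coordDomain x) := by
    refine ((trivializationAt E3 (fun x : M => TangentSpace (𝓡 3) x) x
      ).contMDiffOn_section_baseSet_iff).2 ?_
    exact (contMDiffOn_const (c := w)).congr fun z hz => coord_ofCoord hz w
  exact h.contMDiffAt ((trivializationAt E3 (fun x : M => TangentSpace (𝓡 3) x) x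
    ).open_baseSet.mem_nhds hy)

lemma contMDiffAt_coord {x : M} {X : VField M}
    (hX : ContMDiffAt (𝓡 3) ((𝓡 3).prod 𝓘(ℝ, E3)) ∞ (fun z => TotalSpace.mk' E3 z (X z)) x) :
    ContMDiffAt (𝓡 3) 𝓘(ℝ, E3) ∞ (fun z => coord x z (X z)) x :=
  (contMDiffAt_totalSpace.1 hX).2

/-- Near its base point, the extension of a tangent vector has constant coordinates. -/
lemma extend_eventuallyEq_ofCoord {x : M} (v : TangentSpace (𝓡 3) x) :
    ∀ᶠ y in 𝓝 x, (FiberBundle.extend E3 v : VField M) y = ofCoord x y (coord x x v) := by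
  filter_upwards [coordDomain_mem_nhds x] with y hy
  exact (ofCoord_eq_symm hy _).symm

lemma smoothAlongAt_iff {υ : ℝ → M} {V : FieldAlong υ} {t : ℝ} :
    SmoothAlongAt υ V t ↔ ContMDiffAt 𝓘(ℝ, ℝ) (𝓡 3) ∞ υ t ∧
      ContDiffAt ℝ ∞ (fun u => coord (υ t) (υ u) (V u)) t := by
  rw [SmoothAlongAt, contMDiffAt_totalSpace, ← contMDiffAt_iff_contDiffAt]
  rfl

lemma SmoothAlongAt.curve {υ : ℝ → M} {V : FieldAlong υ} {t : ℝ} (hV : SmoothAlongAt υ V t) :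
    ContMDiffAt 𝓘(ℝ, ℝ) (𝓡 3) ∞ υ t := (smoothAlongAt_iff.1 hV).1

lemma eventually_mem_coordDomain {υ : ℝ → M} {t : ℝ} (hυ : ContMDiffAt 𝓘(ℝ, ℝ) (𝓡 3) ∞ υ t) :
    ∀ᶠ u in 𝓝 t, υ u ∈ coordDomain (υ t) :=
  hυ.continuousAt (coordDomain_mem_nhds (υ t))

lemma SmoothAlongAt.congr {υ : ℝ → M} {V W : FieldAlong υ} {t : ℝ} (hV : SmoothAlongAt υ V t)
    (h : ∀ᶠ u in 𝓝 t, W u = V u) : SmoothAlongAt υ W t :=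
  ContMDiffAt.congr_of_eventuallyEq hV (h.mono fun u hu => by simp only [hu])

lemma SmoothAlongAt.add {υ : ℝ → M} {V W : FieldAlong υ} {t : ℝ} (hV : SmoothAlongAt υ V t)
    (hW : SmoothAlongAt υ W t) : SmoothAlongAt υ (fun u => V u + W u) t := by
  rw [smoothAlongAt_iff] at *
  refine ⟨hV.1, (hV.2.add hW.2).congr_of_eventuallyEq ?_⟩
  filter_upwards [eventually_mem_coordDomain hV.1] with u hu
  exact coord_add hu _ _

lemma SmoothAlongAt.smul {υ : ℝ → M} {V : FieldAlong υ} {f : ℝ → ℝ} {t : ℝ}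
    (hf : ContDiffAt ℝ ∞ f t) (hV : SmoothAlongAt υ V t) :
    SmoothAlongAt υ (fun u => f u • V u) t := by
  rw [smoothAlongAt_iff] at *
  refine ⟨hV.1, (hf.smul hV.2).congr_of_eventuallyEq ?_⟩
  filter_upwards [eventually_mem_coordDomain hV.1] with u hu
  exact coord_smul hu _ _

/-- The restriction of a smooth vector field to a smooth curve is smooth. -/
lemma smoothAlongAt_comp {υ : ℝ → M} {X : VField M} {t : ℝ}
    (hX : ContMDiffAt (𝓡 3) ((𝓡 3).prod 𝓘(ℝ, E3)) ∞ (fun y => TotalSpace.mk' E3 y (X y)) (υ t))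
    (hυ : ContMDiffAt 𝓘(ℝ, ℝ) (𝓡 3) ∞ υ t) : SmoothAlongAt υ (fun u => X (υ u)) t :=
  ContMDiffAt.comp t hX hυ

/-- The velocity of a smooth curve is a smooth field along it. -/
lemma smoothAlongAt_velocity {υ : ℝ → M} {I : Set ℝ} (hI : IsOpen I)
    (hυ : ContMDiffOn 𝓘(ℝ, ℝ) (𝓡 3) ∞ υ I) {t : ℝ} (ht : t ∈ I) :
    SmoothAlongAt υ (velocity υ) t := by
  have h1 := hυ.contMDiffOn_tangentMapWithin (m := ∞) (by simp) hI.uniqueMDiffOn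
  have h2 : ContMDiff 𝓘(ℝ, ℝ) (𝓘(ℝ, ℝ).prod 𝓘(ℝ, ℝ)) ∞
      (fun u : ℝ => TotalSpace.mk' ℝ (E := fun u : ℝ => TangentSpace 𝓘(ℝ, ℝ) u) u (1 : ℝ)) :=
    contMDiff_vectorSpace_iff_contDiff.2 contDiff_const
  have h3 := (h1.comp h2.contMDiffOn (s := I) fun u hu => hu).contMDiffAt (hI.mem_nhds ht)
  refine h3.congr_of_eventuallyEq ?_
  filter_upwards [hI.mem_nhds ht] with u hu
  simp only [Function.comp, tangentMapWithin, mfderivWithin_of_isOpen hI hu]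
  rfl

lemma contDiffAt_g {S : AlmostContactPseudoMetric M} {υ : ℝ → M} {V W : FieldAlong υ} {t : ℝ}
    (hV : SmoothAlongAt υ V t) (hW : SmoothAlongAt υ W t) :
    ContDiffAt ℝ ∞ (fun u => S.g (υ u) (V u) (W u)) t := by
  have hg : ContMDiffAt 𝓘(ℝ, ℝ) ((𝓡 3).prod 𝓘(ℝ, E3 →L[ℝ] E3 →L[ℝ] ℝ)) ∞
      (fun u => TotalSpace.mk' (E3 →L[ℝ] E3 →L[ℝ] ℝ)
        (E := fun x : M => TangentSpace (𝓡 3) x →L[ℝ] TangentSpace (𝓡 3) x →L[ℝ] Trivial M ℝ x)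
        (υ u) (S.g (υ u))) t := (S.smooth_g (υ t)).comp t hV.curve
  have h := ContMDiffAt.clm_bundle_apply₂ (F₃ := ℝ) (E₃ := Trivial M ℝ) (b := υ)
    (ψ := fun u => S.g (υ u)) hg hV hW
  rw [contMDiffAt_totalSpace] at h
  exact contMDiffAt_iff_contDiffAt.1 h.2

lemma SmoothAlongAt.φ (S : AlmostContactPseudoMetric M) {υ : ℝ → M} {V : FieldAlong υ} {t : ℝ}
    (hV : SmoothAlongAt υ V t) : SmoothAlongAt υ (fun u => S.φ (υ u) (V u)) t :=
  ContMDiffAt.clm_bundle_apply (b := υ) (ϕ := fun u => S.φ (υ u))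
    ((S.smooth_φ (υ t)).comp t hV.curve) hV

/-! ### The covariant derivative along a curve -/

/-- The vector field `X` is smooth at `x`. -/
def SmoothFieldAt (X : VField M) (x : M) : Prop :=
  ContMDiffAt (𝓡 3) ((𝓡 3).prod 𝓘(ℝ, E3)) ∞ (fun y => TotalSpace.mk' E3 y (X y)) x

lemma SmoothFieldAt.mdifferentiableAt {X : VField M} {x : M} (hX : SmoothFieldAt X x) :
    MDifferentiableAt (𝓡 3) ((𝓡 3).prod 𝓘(ℝ, E3)) (fun y => TotalSpace.mk' E3 y (X y)) x :=
  ContMDiffAt.mdifferentiableAt hX (by simp)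

lemma smoothFieldAt_ofCoord (x : M) (w : E3) : SmoothFieldAt (fun y => ofCoord x y w) x :=
  contMDiffAt_ofCoord x (mem_of_mem_nhds (coordDomain_mem_nhds x)) w

/-- The covariant derivative along a curve, in terms of the fields with constant coordinates. -/
lemma covDerivAlong_eq (D : Connection M) (υ : ℝ → M) (V : FieldAlong υ) (t : ℝ) :
    covDerivAlong D υ V t =
      D (fun y => ofCoord (υ t) y (coord (υ t) (υ t) (V t))) (υ t) (velocity υ t)
        + ofCoord (υ t) (υ t) (deriv (fun u => coord (υ t) (υ u) (V u)) t) := by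
  have hmem := mem_of_mem_nhds (coordDomain_mem_nhds (υ t))
  have h : D (FiberBundle.extend E3 (V t)) (υ t)
      = D (fun y => ofCoord (υ t) y (coord (υ t) (υ t) (V t))) (υ t) :=
    D.isCovariantDerivativeOn.congr_of_eventuallyEq
      (FiberBundle.mdifferentiableAt_extend (𝓡 3) E3 (V t))
      (smoothFieldAt_ofCoord _ _).mdifferentiableAt univ_mem
      (extend_eventuallyEq_ofCoord (V t))
  rw [ofCoord_eq_symm hmem, ← h]
  rfl

lemma covDerivAlong_congr (D : Connection M) {υ : ℝ → M} {V W : FieldAlong υ} {t : ℝ}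
    (h : ∀ᶠ u in 𝓝 t, V u = W u) : covDerivAlong D υ V t = covDerivAlong D υ W t := by
  have h1 : deriv (fun u => coord (υ t) (υ u) (V u)) t
      = deriv (fun u => coord (υ t) (υ u) (W u)) t :=
    EventuallyEq.deriv_eq (h.mono fun u hu => by simp only [hu])
  rw [covDerivAlong_eq, covDerivAlong_eq, h1, h.self_of_nhds]

lemma differentiableAt_coord {υ : ℝ → M} {V : FieldAlong υ} {t : ℝ} (hV : SmoothAlongAt υ V t) :
    DifferentiableAt ℝ (fun u => coord (υ t) (υ u) (V u)) t :=
  (smoothAlongAt_iff.1 hV).2.differentiableAt (by simp)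

lemma covDerivAlong_add (D : Connection M) {υ : ℝ → M} {V W : FieldAlong υ} {t : ℝ}
    (hV : SmoothAlongAt υ V t) (hW : SmoothAlongAt υ W t) :
    covDerivAlong D υ (fun u => V u + W u) t
      = covDerivAlong D υ V t + covDerivAlong D υ W t := by
  have hmem := mem_of_mem_nhds (coordDomain_mem_nhds (υ t))
  have h1 : deriv (fun u => coord (υ t) (υ u) (V u + W u)) t
      = deriv (fun u => coord (υ t) (υ u) (V u)) t
        + deriv (fun u => coord (υ t) (υ u) (W u)) t := by
    rw [← deriv_fun_add (differentiableAt_coord hV) (differentiableAt_coord hW)]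
    refine EventuallyEq.deriv_eq ?_
    filter_upwards [eventually_mem_coordDomain hV.curve] with u hu using coord_add hu _ _
  have h2 : D (fun y => ofCoord (υ t) y (coord (υ t) (υ t) (V t + W t))) (υ t)
      = D (fun y => ofCoord (υ t) y (coord (υ t) (υ t) (V t))) (υ t)
        + D (fun y => ofCoord (υ t) y (coord (υ t) (υ t) (W t))) (υ t) := by
    rw [← D.isCovariantDerivativeOn.add (s := Set.univ)
      (smoothFieldAt_ofCoord _ _).mdifferentiableAt (smoothFieldAt_ofCoord _ _).mdifferentiableAt]
    congr 1
    funext y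
    rw [coord_add hmem, map_add]
    rfl
  simp only [covDerivAlong_eq, h1, h2, map_add, add_apply]
  abel

lemma covDerivAlong_smul (D : Connection M) {υ : ℝ → M} {V : FieldAlong υ} {f : ℝ → ℝ} {t : ℝ}
    (hf : ContDiffAt ℝ ∞ f t) (hV : SmoothAlongAt υ V t) :
    covDerivAlong D υ (fun u => f u • V u) t
      = deriv f t • V t + f t • covDerivAlong D υ V t := by
  have hmem := mem_of_mem_nhds (coordDomain_mem_nhds (υ t))
  have hf' : DifferentiableAt ℝ f t := hf.differentiableAt (by simp)
  have h1 : deriv (fun u => coord (υ t) (υ u) (f u • V u)) t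
      = f t • deriv (fun u => coord (υ t) (υ u) (V u)) t
        + deriv f t • coord (υ t) (υ t) (V t) := by
    rw [← deriv_fun_smul hf' (differentiableAt_coord hV)]
    refine EventuallyEq.deriv_eq ?_
    filter_upwards [eventually_mem_coordDomain hV.curve] with u hu using coord_smul hu _ _
  have h2 : D (fun y => ofCoord (υ t) y (coord (υ t) (υ t) (f t • V t))) (υ t)
      = f t • D (fun y => ofCoord (υ t) y (coord (υ t) (υ t) (V t))) (υ t) := by
    rw [← D.isCovariantDerivativeOn.smul_const (s := Set.univ) (f t)
      (smoothFieldAt_ofCoord _ _).mdifferentiableAt]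
    congr 1
    funext y
    rw [coord_smul hmem, map_smul]
    rfl
  simp only [covDerivAlong_eq, h1, h2, map_add, map_smul, smul_apply,
    ofCoord_coord hmem, smul_add]
  abel

lemma euclidean_three_expansion (w : E3) :
    w = w 0 • EuclideanSpace.single 0 (1 : ℝ) + w 1 • EuclideanSpace.single 1 (1 : ℝ)
      + w 2 • EuclideanSpace.single 2 (1 : ℝ) := by
  ext i
  fin_cases i <;> simp

/-- The fields of the coordinate frame centred at `x`, extended by zero outside the chart. -/
def frame (x : M) (i : Fin 3) : VField M := fun y => ofCoord x y (EuclideanSpace.single i (1 : ℝ))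

lemma smoothFieldAt_frame (x : M) (i : Fin 3) : SmoothFieldAt (frame x i) x :=
  smoothFieldAt_ofCoord _ _

lemma ofCoord_eq_frame (x y : M) (w : E3) :
    ofCoord x y w = w 0 • frame x 0 y + w 1 • frame x 1 y + w 2 • frame x 2 y := by
  conv_lhs => rw [euclidean_three_expansion w]
  simp only [map_add, map_smul, frame]

lemma eq_frame_expansion {x y : M} (hy : y ∈ coordDomain x) (v : TangentSpace (𝓡 3) y) :
    v = coord x y v 0 • frame x 0 y + coord x y v 1 • frame x 1 y
      + coord x y v 2 • frame x 2 y := by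
  rw [← ofCoord_eq_frame, ofCoord_coord hy]

lemma SmoothFieldAt.smul {f : M → ℝ} {X : VField M} {x : M}
    (hf : ContMDiffAt (𝓡 3) 𝓘(ℝ, ℝ) ∞ f x) (hX : SmoothFieldAt X x) : SmoothFieldAt (f • X) x :=
  ContMDiffAt.smul_section hf hX

lemma SmoothFieldAt.add {X Y : VField M} {x : M}
    (hX : SmoothFieldAt X x) (hY : SmoothFieldAt Y x) : SmoothFieldAt (X + Y) x :=
  ContMDiffAt.add_section hX hY

lemma connection_add (D : Connection M) {X Y : VField M} {x : M}
    (hX : SmoothFieldAt X x) (hY : SmoothFieldAt Y x) : D (X + Y) x = D X x + D Y x :=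
  D.isCovariantDerivativeOn.add (s := Set.univ) hX.mdifferentiableAt hY.mdifferentiableAt

lemma connection_smul_apply (D : Connection M) {f : M → ℝ} {X : VField M} {x : M}
    (hf : ContMDiffAt (𝓡 3) 𝓘(ℝ, ℝ) ∞ f x) (hX : SmoothFieldAt X x)
    (v : TangentSpace (𝓡 3) x) :
    D (f • X) x v = f x • D X x v + mvfderiv (𝓡 3) f x v • X x := by
  rw [D.isCovariantDerivativeOn.leibniz (s := Set.univ) hX.mdifferentiableAt
    (hf.mdifferentiableAt (by simp))]
  rfl

lemma contMDiffAt_coord_apply {X : VField M} {x : M} (hX : SmoothFieldAt X x) (i : Fin 3) :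
    ContMDiffAt (𝓡 3) 𝓘(ℝ, ℝ) ∞ (fun y => coord x y (X y) i) x :=
  (EuclideanSpace.proj (𝕜 := ℝ) i).contMDiff.contMDiffAt.comp x (contMDiffAt_coord hX)

omit [IsManifold (𝓡 3) ∞ M] in
lemma mvfderiv_apply_coordinate {Φ : M → E3} {x : M} (hΦ : MDifferentiableAt (𝓡 3) 𝓘(ℝ, E3) Φ x)
    (v : TangentSpace (𝓡 3) x) (i : Fin 3) :
    mvfderiv (𝓡 3) (fun y => Φ y i) x v = mvfderiv (𝓡 3) Φ x v i := by
  have h := ((EuclideanSpace.proj i : E3 →L[ℝ] ℝ).hasMFDerivAt (x := Φ x)).comp x hΦ.hasMFDerivAt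
  have h' : mfderiv (𝓡 3) 𝓘(ℝ, ℝ) (fun y => Φ y i) x = _ := h.mfderiv
  rw [mvfderiv, h']
  rfl

/-- The coordinate formula for a connection at the centre of a bundle chart: the field with constant
coordinates `X x` contributes the Christoffel term, and the derivative of the coordinates of `X` is
the remaining part of the Leibniz rule. -/
lemma connection_eq_coord (D : Connection M) {X : VField M} {x : M} (hX : SmoothFieldAt X x)
    (v : TangentSpace (𝓡 3) x) :
    D X x v = D (fun y => ofCoord x y (coord x x (X x))) x v
      + ofCoord x x (mvfderiv (𝓡 3) (fun y => coord x y (X y)) x v) := by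
  have hs := fun (f : Fin 3 → M → ℝ) (hf : ∀ i, ContMDiffAt (𝓡 3) 𝓘(ℝ, ℝ) ∞ (f i) x)
      (i : Fin 3) =>
    (smoothFieldAt_frame x i).smul (hf i)
  -- The formula is applied to the coordinates of `X` and to their constant values at `x`.
  have key : ∀ (f : Fin 3 → M → ℝ) (_ : ∀ i, ContMDiffAt (𝓡 3) 𝓘(ℝ, ℝ) ∞ (f i) x) (Y : VField M),
      SmoothFieldAt Y x →
      (∀ᶠ y in 𝓝 x, Y y = (f 0 • frame x 0 + f 1 • frame x 1 + f 2 • frame x 2) y) →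
      D Y x v = (f 0 x • D (frame x 0) x v + mvfderiv (𝓡 3) (f 0) x v • frame x 0 x)
        + (f 1 x • D (frame x 1) x v + mvfderiv (𝓡 3) (f 1) x v • frame x 1 x)
        + (f 2 x • D (frame x 2) x v + mvfderiv (𝓡 3) (f 2) x v • frame x 2 x) := by
    intro f hf Y hY hYf
    rw [D.isCovariantDerivativeOn.congr_of_eventuallyEq hY.mdifferentiableAt
      (((hs f hf 0).add (hs f hf 1)).add (hs f hf 2)).mdifferentiableAt univ_mem hYf,
      connection_add D ((hs f hf 0).add (hs f hf 1)) (hs f hf 2),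
      connection_add D (hs f hf 0) (hs f hf 1)]
    simp only [add_apply, connection_smul_apply D (hf _) (smoothFieldAt_frame x _)]
  rw [key (fun i y => coord x y (X y) i) (contMDiffAt_coord_apply hX) X hX
      (by filter_upwards [coordDomain_mem_nhds x] with y hy using eq_frame_expansion hy (X y)),
    key (fun i _ => coord x x (X x) i) (fun i => contMDiffAt_const) _ (smoothFieldAt_ofCoord _ _)
      (Eventually.of_forall fun y => ofCoord_eq_frame x y _),
    ofCoord_eq_frame x x (mvfderiv (𝓡 3) (fun y => coord x y (X y)) x v)]
  simp only [mvfderiv_const, mvfderiv_apply_coordinate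
    ((contMDiffAt_coord hX).mdifferentiableAt (by simp)), zero_apply, zero_smul]
  abel

/-- Along a curve, the covariant derivative of the restriction of a vector field `X` is
`∇_{υ'} X`. -/
lemma covDerivAlong_comp (D : Connection M) {υ : ℝ → M} {X : VField M} {t : ℝ}
    (hX : SmoothFieldAt X (υ t)) (hυ : ContMDiffAt 𝓘(ℝ, ℝ) (𝓡 3) ∞ υ t) :
    covDerivAlong D υ (fun u => X (υ u)) t = D X (υ t) (velocity υ t) := by
  rw [covDerivAlong_eq, connection_eq_coord D hX]
  congr 2
  have h := ((contMDiffAt_coord hX).mdifferentiableAt (by simp)).hasMFDerivAt.comp t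
    (hυ.mdifferentiableAt (by simp)).hasMFDerivAt
  have h' : mfderiv 𝓘(ℝ, ℝ) 𝓘(ℝ, E3) (fun u => coord (υ t) (υ u) (X (υ u))) t = _ := h.mfderiv
  rw [← fderiv_apply_one_eq_deriv, ← mfderiv_eq_fderiv, h']
  rfl

/-- Every field with constant coordinates agrees near the centre of the chart with a smooth
vector field on the whole manifold. -/
lemma exists_smoothField_eventuallyEq_ofCoord [T2Space M] (x : M) (w : E3) :
    ∃ X : VField M, SmoothField X ∧ ∀ᶠ y in 𝓝 x, X y = ofCoord x y w := by
  have ψ : SmoothBumpFunction (𝓡 3) x := Classical.arbitrary _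
  refine ⟨(ψ : M → ℝ) • fun y => ofCoord x y w, ?_, ?_⟩
  · refine ContMDiffOn.smul_section_of_tsupport (u := coordDomain x) ψ.contMDiff.contMDiffOn
      (trivializationAt E3 (fun x : M => TangentSpace (𝓡 3) x) x).open_baseSet
      ψ.tsupport_subset_chartAt_source ?_
    exact fun y hy => (contMDiffAt_ofCoord x hy w).contMDiffWithinAt
  · filter_upwards [ψ.eventuallyEq_one] with y hy
    simp [hy]

lemma exists_smoothField_apply_eq [T2Space M] {x : M} (v : TangentSpace (𝓡 3) x) :
    ∃ X : VField M, SmoothField X ∧ X x = v := by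
  obtain ⟨X, hX, h⟩ := exists_smoothField_eventuallyEq_ofCoord x (coord x x v)
  exact ⟨X, hX, h.self_of_nhds.trans
    (ofCoord_coord (mem_of_mem_nhds (coordDomain_mem_nhds x)) v)⟩

lemma SmoothField.at {X : VField M} (hX : SmoothField X) (x : M) : SmoothFieldAt X x := hX x

/-! ### Compatibility with the metric -/

lemma smoothAlongAt_frame {υ : ℝ → M} {t : ℝ} (hυ : ContMDiffAt 𝓘(ℝ, ℝ) (𝓡 3) ∞ υ t)
    (i : Fin 3) : SmoothAlongAt υ (fun u => frame (υ t) i (υ u)) t :=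
  smoothAlongAt_comp (smoothFieldAt_frame _ i) hυ

lemma SmoothAlongAt.contDiffAt_coord_apply {υ : ℝ → M} {V : FieldAlong υ} {t : ℝ}
    (hV : SmoothAlongAt υ V t) (i : Fin 3) :
    ContDiffAt ℝ ∞ (fun u => coord (υ t) (υ u) (V u) i) t :=
  (EuclideanSpace.proj i : E3 →L[ℝ] ℝ).contDiff.contDiffAt.comp t (smoothAlongAt_iff.1 hV).2

/-- The product rule for `g(V, W)` along `υ` holds at the parameter `t`. -/
def ProductRuleAt (S : AlmostContactPseudoMetric M) (D : Connection M) (υ : ℝ → M)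
    (V W : FieldAlong υ) (t : ℝ) : Prop :=
  HasDerivAt (fun u => S.g (υ u) (V u) (W u))
    (S.g (υ t) (covDerivAlong D υ V t) (W t) + S.g (υ t) (V t) (covDerivAlong D υ W t)) t

section ProductRule

variable {S : AlmostContactPseudoMetric M} {D : Connection M} {υ : ℝ → M}
  {V V' W : FieldAlong υ} {f : ℝ → ℝ} {t : ℝ}

lemma ProductRuleAt.symm (h : ProductRuleAt S D υ V W t) : ProductRuleAt S D υ W V t := by
  rw [ProductRuleAt] at *
  rw [add_comm, S.g_symm _ (W t), S.g_symm _ _ (V t)]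
  exact h.congr_of_eventuallyEq (Eventually.of_forall fun u => S.g_symm _ _ _)

lemma ProductRuleAt.congr_left (h : ProductRuleAt S D υ V W t) (hV : ∀ᶠ u in 𝓝 t, V' u = V u) :
    ProductRuleAt S D υ V' W t := by
  rw [ProductRuleAt] at *
  rw [covDerivAlong_congr D hV, hV.self_of_nhds]
  exact h.congr_of_eventuallyEq (hV.mono fun u hu => by simp only [hu])

lemma ProductRuleAt.add_left (h : ProductRuleAt S D υ V W t) (h' : ProductRuleAt S D υ V' W t)
    (hV : SmoothAlongAt υ V t) (hV' : SmoothAlongAt υ V' t) :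
    ProductRuleAt S D υ (fun u => V u + V' u) W t := by
  rw [ProductRuleAt] at *
  rw [covDerivAlong_add D hV hV']
  simp only [map_add, add_apply]
  exact (h.add h').congr_deriv (by ring)

lemma ProductRuleAt.smul_left (h : ProductRuleAt S D υ V W t) (hf : ContDiffAt ℝ ∞ f t)
    (hV : SmoothAlongAt υ V t) : ProductRuleAt S D υ (fun u => f u • V u) W t := by
  rw [ProductRuleAt] at *
  rw [covDerivAlong_smul D hf hV]
  simp only [map_add, map_smul, add_apply, smul_apply, smul_eq_mul]
  exact ((hf.differentiableAt (by simp)).hasDerivAt.mul h).congr_deriv (by ring)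

/-- The product rule for `V` follows from the product rule for a coordinate frame. -/
lemma ProductRuleAt.of_frame (hV : SmoothAlongAt υ V t)
    (h : ∀ i, ProductRuleAt S D υ (fun u => frame (υ t) i (υ u)) W t) :
    ProductRuleAt S D υ V W t := by
  have hE := smoothAlongAt_frame hV.curve
  have hf := hV.contDiffAt_coord_apply
  have hs := fun i => (hE i).smul (hf i)
  have hP := fun i => (h i).smul_left (hf i) (hE i)
  refine (((hP 0).add_left (hP 1) (hs 0) (hs 1)).add_left (hP 2)
    ((hs 0).add (hs 1)) (hs 2)).congr_left ?_
  filter_upwards [eventually_mem_coordDomain hV.curve] with u hu using eq_frame_expansion hu _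

end ProductRule

lemma contMDiffAt_g (S : AlmostContactPseudoMetric M) {X Y : VField M} {x : M}
    (hX : SmoothFieldAt X x) (hY : SmoothFieldAt Y x) :
    ContMDiffAt (𝓡 3) 𝓘(ℝ, ℝ) ∞ (fun y => S.g y (X y) (Y y)) x := by
  have h := ContMDiffAt.clm_bundle_apply₂ (F₃ := ℝ) (E₃ := Trivial M ℝ) (b := id)
    (ψ := fun y => S.g y) (S.smooth_g x) hX hY
  exact (contMDiffAt_totalSpace.1 h).2

/-- The Levi-Civita connection is metric along curves. -/
lemma IsLeviCivita.productRuleAt {S : AlmostContactPseudoMetric M} {D : Connection M}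
    (hD : IsLeviCivita S D) {υ : ℝ → M} {V W : FieldAlong υ} {t : ℝ}
    (hV : SmoothAlongAt υ V t) (hW : SmoothAlongAt υ W t) : ProductRuleAt S D υ V W t := by
  refine ProductRuleAt.of_frame hV fun i => (ProductRuleAt.of_frame hW fun j => ?_).symm
  have hi := smoothFieldAt_frame (υ t) i
  have hj := smoothFieldAt_frame (υ t) j
  rw [ProductRuleAt, covDerivAlong_comp D hi hV.curve, covDerivAlong_comp D hj hV.curve,
    ← hD.metric _ _ _ _ hj.mdifferentiableAt hi.mdifferentiableAt]
  have h := ((contMDiffAt_g S hj hi).mdifferentiableAt (by simp)).hasMFDerivAt.comp t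
    (hV.curve.mdifferentiableAt (by simp)).hasMFDerivAt
  have h' : mfderiv 𝓘(ℝ, ℝ) 𝓘(ℝ, ℝ)
      (fun u => S.g (υ u) (frame (υ t) j (υ u)) (frame (υ t) i (υ u))) t = _ := h.mfderiv
  refine ((contDiffAt_g (S := S) (smoothAlongAt_frame hV.curve j)
    (smoothAlongAt_frame hV.curve i)).differentiableAt (by simp)).hasDerivAt.congr_deriv ?_
  rw [← fderiv_apply_one_eq_deriv, ← mfderiv_eq_fderiv, h']
  rfl

/-! ### Smoothness of the covariant derivative along a curve -/

lemma contDiffAt_coord_of_mem {υ : ℝ → M} {V : FieldAlong υ} {x : M} {u : ℝ}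
    (hV : SmoothAlongAt υ V u) (hu : υ u ∈ coordDomain x) :
    ContDiffAt ℝ ∞ (fun s => coord x (υ s) (V s)) u :=
  contMDiffAt_iff_contDiffAt.1 ((((trivializationAt E3 (fun x : M => TangentSpace (𝓡 3) x) x
    ).contMDiffAt_iff (f := fun s => TotalSpace.mk' E3 (υ s) (V s))
      ((Trivialization.mem_source _).2 hu)).1 hV).2)

/-- For a smooth connection, the covariant derivative of a smooth field along a smooth curve is
smooth. The field is assumed smooth near `t`, since smoothness of class `C^∞` at a single point does
not spread to a neighbourhood. -/
lemma IsLeviCivita.smoothAlongAt_covDerivAlong [T2Space M] {S : AlmostContactPseudoMetric M}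
    {D : Connection M} (hD : IsLeviCivita S D) {υ : ℝ → M} {V : FieldAlong υ} {t : ℝ}
    (hVt : ∀ᶠ u in 𝓝 t, SmoothAlongAt υ V u) (hT : SmoothAlongAt υ (velocity υ) t) :
    SmoothAlongAt υ (covDerivAlong D υ V) t := by
  have hV := hVt.self_of_nhds
  -- Smoothness of the connection concerns global fields, hence a frame of global fields.
  choose E hE hEf using fun i => exists_smoothField_eventuallyEq_ofCoord (υ t)
    (EuclideanSpace.single i (1 : ℝ))
  have hυ := hV.curve
  have hf := hV.contDiffAt_coord_apply
  have hcomp : ∀ i, SmoothAlongAt υ (fun u => E i (υ u)) t := fun i =>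
    smoothAlongAt_comp (hE i _) hυ
  have hexp : ∀ᶠ u in 𝓝 t, V u = (coord (υ t) (υ u) (V u) 0 • E 0 (υ u)
      + coord (υ t) (υ u) (V u) 1 • E 1 (υ u)) + coord (υ t) (υ u) (V u) 2 • E 2 (υ u) := by
    filter_upwards [eventually_mem_coordDomain hυ, hυ.continuousAt.eventually (hEf 0),
      hυ.continuousAt.eventually (hEf 1), hυ.continuousAt.eventually (hEf 2)] with u hu h0 h1 h2
    rw [h0, h1, h2]
    exact eq_frame_expansion hu _
  have hDE : ∀ i, SmoothAlongAt υ (fun u => D (E i) (υ u) (velocity υ u)) t := by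
    intro i
    have h := (hD.smooth.contMDiff.contMDiff (σ := E i) (by simpa using (hE i).contMDiffOn))
      |>.contMDiffAt (x := υ t) univ_mem
    exact ContMDiffAt.clm_bundle_apply (b := υ) (ϕ := fun u => D (E i) (υ u)) (h.comp t hυ) hT
  have hf' : ∀ i, ContDiffAt ℝ ∞ (deriv fun u => coord (υ t) (υ u) (V u) i) t := fun i => by
    exact ((hf i).fderiv_right (m := ∞) (by simp)).clm_apply contDiffAt_const
  have hs : ∀ i, SmoothAlongAt υ (fun u => deriv (fun u => coord (υ t) (υ u) (V u) i) u • E i (υ u)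
      + coord (υ t) (υ u) (V u) i • D (E i) (υ u) (velocity υ u)) t := fun i =>
    ((hcomp i).smul (hf' i)).add ((hDE i).smul (hf i))
  refine (((hs 0).add (hs 1)).add (hs 2)).congr ?_
  have hcurve : ∀ᶠ u in 𝓝 t, ContMDiffAt 𝓘(ℝ, ℝ) (𝓡 3) ∞ υ u :=
    hVt.mono fun u hu => hu.curve
  have hfe : ∀ i, ∀ᶠ u in 𝓝 t, ContDiffAt ℝ ∞ (fun u => coord (υ t) (υ u) (V u) i) u := fun i => by
    filter_upwards [hVt, eventually_mem_coordDomain hυ] with u hu hm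
    exact (EuclideanSpace.proj i : E3 →L[ℝ] ℝ).contDiff.contDiffAt.comp u
      (contDiffAt_coord_of_mem hu hm)
  filter_upwards [hexp.eventually_nhds, hcurve, hfe 0, hfe 1, hfe 2] with u hu hc h0 h1 h2
  have hEu : ∀ i, SmoothAlongAt υ (fun u => E i (υ u)) u := fun i =>
    smoothAlongAt_comp (hE i _) hc
  rw [covDerivAlong_congr D hu, covDerivAlong_add D (((hEu 0).smul h0).add ((hEu 1).smul h1))
    ((hEu 2).smul h2), covDerivAlong_add D ((hEu 0).smul h0) ((hEu 1).smul h1),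
    covDerivAlong_smul D h0 (hEu 0), covDerivAlong_smul D h1 (hEu 1),
    covDerivAlong_smul D h2 (hEu 2)]
  simp only [covDerivAlong_comp D ((hE _).at _) hc]

/-! ### Algebra of an almost contact pseudo-metric structure -/

section Algebra

variable (S : AlmostContactPseudoMetric M) {x : M}

lemma φ_ξ : S.φ x (S.ξ x) = 0 := by
  have h0 : S.φ x (S.φ x (S.ξ x)) = 0 := by rw [S.φ_sq, S.η_ξ]; simp
  have h1 := S.φ_sq x (S.φ x (S.ξ x))
  rw [h0, map_zero] at h1
  have h2 : S.φ x (S.ξ x) = S.η x (S.φ x (S.ξ x)) • S.ξ x := by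
    linear_combination (norm := module) h1
  have h3 := congrArg (S.φ x) h2
  rw [h0, map_smul] at h3
  rcases smul_eq_zero.1 h3.symm with h | h
  · rw [h2, h, zero_smul]
  · exact h

lemma η_φ (v : TangentSpace (𝓡 3) x) : S.η x (S.φ x v) = 0 := by
  have h1 : S.φ x (S.φ x (S.φ x v)) = -S.φ x v := by
    rw [S.φ_sq x v, map_add, map_neg, map_smul, φ_ξ]; simp
  rw [S.φ_sq x (S.φ x v), add_eq_left] at h1
  have h2 := congrArg (S.η x) h1
  simpa [S.η_ξ] using h2

lemma g_ξ (v : TangentSpace (𝓡 3) x) : S.g x v (S.ξ x) = S.ε * S.η x v := by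
  have h := S.compatible x v (S.ξ x)
  rw [φ_ξ, map_zero, S.η_ξ] at h
  linarith

lemma η_eq (v : TangentSpace (𝓡 3) x) : S.η x v = S.ε * S.g x v (S.ξ x) := by
  rw [g_ξ, ← mul_assoc, ← sq, S.ε_sq, one_mul]

lemma g_ξ_ξ : S.g x (S.ξ x) (S.ξ x) = S.ε := by
  rw [g_ξ, S.η_ξ, mul_one]

/-- The structure endomorphism is skew-adjoint. -/
lemma g_φ_left (v w : TangentSpace (𝓡 3) x) : S.g x (S.φ x v) w = -S.g x v (S.φ x w) := by
  have h := S.compatible x (S.φ x v) w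
  rw [S.φ_sq, η_φ, map_add, map_neg, map_smul, add_apply, neg_apply, smul_apply,
    S.g_symm x (S.ξ x), g_ξ, η_φ] at h
  simp only [smul_eq_mul, mul_zero, add_zero, zero_mul, sub_zero] at h
  exact h.symm

lemma g_φ_self (v : TangentSpace (𝓡 3) x) : S.g x (S.φ x v) v = 0 := by
  have h := g_φ_left S v v
  rw [S.g_symm x v] at h
  linarith

lemma g_φ_φ {v : TangentSpace (𝓡 3) x} (hv : S.η x v = 0) (w : TangentSpace (𝓡 3) x) :
    S.g x (S.φ x w) (S.φ x v) = S.g x w v := by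
  rw [S.compatible, hv]; ring

/-- A unit vector `v` in the contact plane, `φ v` and `ξ` are linearly independent. -/
lemma linearIndependent_adaptedFrame {v : TangentSpace (𝓡 3) x} (hη : S.η x v = 0)
    (hg : S.g x v v = 1) : LinearIndependent ℝ ![v, S.φ x v, S.ξ x] := by
  rw [Fintype.linearIndependent_iff]
  intro c hc
  rw [Fin.sum_univ_three] at hc
  simp only [Matrix.cons_val] at hc
  have h0 := congrArg (fun w => S.g x w v) hc
  have h1 := congrArg (fun w => S.g x w (S.φ x v)) hc
  have h2 := congrArg (S.η x) hc
  simp only [map_add, map_smul, add_apply, smul_apply, map_zero, zero_apply, hg, g_φ_self,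
    S.g_symm x v (S.φ x v), S.g_symm x (S.ξ x), g_ξ, hη, η_φ, g_φ_φ S hη, S.η_ξ,
    smul_eq_mul] at h0 h1 h2
  intro i
  fin_cases i
  · simpa using h0
  · simpa using h1
  · simpa using h2

omit [IsManifold (𝓡 3) ∞ M] in
lemma card_eq_finrank_tangentSpace (x : M) :
    Fintype.card (Fin 3) = Module.finrank ℝ (TangentSpace (𝓡 3) x) :=
  (finrank_euclideanSpace_fin (𝕜 := ℝ) (n := 3)).symm

/-- The basis `(v, φ v, ξ)` adapted to a unit vector `v` in the contact plane. -/
def adaptedBasis {v : TangentSpace (𝓡 3) x} (hη : S.η x v = 0) (hg : S.g x v v = 1) :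
    Module.Basis (Fin 3) ℝ (TangentSpace (𝓡 3) x) :=
  basisOfLinearIndependentOfCardEqFinrank (linearIndependent_adaptedFrame S hη hg)
    (card_eq_finrank_tangentSpace x)

lemma coe_adaptedBasis {v : TangentSpace (𝓡 3) x} (hη : S.η x v = 0) (hg : S.g x v v = 1) :
    ⇑(adaptedBasis S hη hg) = ![v, S.φ x v, S.ξ x] := by
  rw [adaptedBasis, coe_basisOfLinearIndependentOfCardEqFinrank]

lemma adaptedBasis_repr {v : TangentSpace (𝓡 3) x} (hη : S.η x v = 0) (hg : S.g x v v = 1)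
    (w : TangentSpace (𝓡 3) x) :
    ⇑((adaptedBasis S hη hg).repr w) = ![S.g x w v, S.g x w (S.φ x v), S.η x w] := by
  have h := (adaptedBasis S hη hg).sum_repr w
  rw [Fin.sum_univ_three, coe_adaptedBasis] at h
  simp only [Matrix.cons_val] at h
  have h0 := congrArg (fun w => S.g x w v) h
  have h1 := congrArg (fun w => S.g x w (S.φ x v)) h
  have h2 := congrArg (S.η x) h
  simp only [map_add, map_smul, add_apply, smul_apply, hg, g_φ_self,
    S.g_symm x v (S.φ x v), S.g_symm x (S.ξ x), g_ξ, hη, η_φ, g_φ_φ S hη, S.η_ξ,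
    smul_eq_mul] at h0 h1 h2
  ext i
  fin_cases i
  · simpa using h0
  · simpa using h1
  · simpa using h2

/-- Expansion of a vector in the adapted basis `(v, φ v, ξ)`. -/
lemma eq_adapted_expansion {v : TangentSpace (𝓡 3) x} (hη : S.η x v = 0) (hg : S.g x v v = 1)
    (w : TangentSpace (𝓡 3) x) :
    w = S.g x w v • v + S.g x w (S.φ x v) • S.φ x v + S.η x w • S.ξ x := by
  have h := (adaptedBasis S hη hg).sum_repr w
  rw [Fin.sum_univ_three, coe_adaptedBasis, adaptedBasis_repr] at h
  exact h.symm

lemma trace_eq {v : TangentSpace (𝓡 3) x} (hη : S.η x v = 0) (hg : S.g x v v = 1)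
    (f : TangentSpace (𝓡 3) x →ₗ[ℝ] TangentSpace (𝓡 3) x) :
    LinearMap.trace ℝ (TangentSpace (𝓡 3) x) f
      = S.g x (f v) v + S.g x (f (S.φ x v)) (S.φ x v) + S.η x (f (S.ξ x)) := by
  rw [LinearMap.trace_eq_matrix_trace ℝ (adaptedBasis S hη hg), Matrix.trace, Fin.sum_univ_three]
  simp only [Matrix.diag_apply, LinearMap.toMatrix_apply, adaptedBasis_repr, coe_adaptedBasis,
    Matrix.cons_val]

end Algebra

/-! ### The covariant derivative of the Reeb field -/

section Reeb

variable {S : AlmostContactPseudoMetric M} {D : Connection M}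

lemma SmoothField.mdifferentiableAt {X : VField M} (hX : SmoothField X) (x : M) :
    MDifferentiableAt (𝓡 3) ((𝓡 3).prod 𝓘(ℝ, E3)) (fun y => TotalSpace.mk' E3 y (X y)) x :=
  (hX.at x).mdifferentiableAt

lemma SmoothField.φ (S : AlmostContactPseudoMetric M) {X : VField M} (hX : SmoothField X) :
    SmoothField (fun y => S.φ y (X y)) :=
  ContMDiff.clm_bundle_apply (b := id) (ϕ := fun y => S.φ y) S.smooth_φ hX

/-- The metric identity for fields whose inner product is constant. -/
lemma IsLeviCivita.g_add_g_eq_zero (hD : IsLeviCivita S D) {Y Z : VField M} (hY : SmoothField Y)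
    (hZ : SmoothField Z) {c : ℝ} (h : ∀ y, S.g y (Y y) (Z y) = c) (x : M)
    (v : TangentSpace (𝓡 3) x) : S.g x (D Y x v) (Z x) + S.g x (Y x) (D Z x v) = 0 := by
  rw [← hD.metric Y Z x v (hY.mdifferentiableAt x) (hZ.mdifferentiableAt x),
    show (fun y => S.g y (Y y) (Z y)) = fun _ => c from funext h, mvfderiv_const]
  rfl

lemma IsLeviCivita.η_reeb (hD : IsLeviCivita S D) (x : M) (v : TangentSpace (𝓡 3) x) :
    S.η x (D S.ξ x v) = 0 := by
  have h := hD.g_add_g_eq_zero S.smooth_ξ S.smooth_ξ (fun y => g_ξ_ξ S) x v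
  rw [S.g_symm x (S.ξ x)] at h
  rw [η_eq, show S.g x (D S.ξ x v) (S.ξ x) = 0 by linarith, mul_zero]

/-- Normality in the direction of the Reeb field, `N_φ(X, ξ) + 2 dη(X, ξ) ξ = 0`, splits into
`dη(X, ξ) = 0` and the invariance of `φ` along `ξ`. -/
lemma IsNormal.twoDEta_eq_zero_and_φ_mlieBracket_eq (hN : IsNormal S) {X : VField M} (hX : SmoothField X) (x : M) :
    twoDEta S X S.ξ x = 0 ∧
      S.φ x (VectorField.mlieBracket (𝓡 3) (fun y => S.φ y (X y)) S.ξ x)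
        = S.φ x (S.φ x (VectorField.mlieBracket (𝓡 3) X S.ξ x)) := by
  have h := hN X S.ξ hX S.smooth_ξ x
  have h0 : (fun y => S.φ y (S.ξ y)) = (0 : VField M) := funext fun y => φ_ξ S
  rw [nijenhuis, h0, VectorField.mlieBracket_zero_right, VectorField.mlieBracket_zero_right] at h
  simp only [Pi.zero_apply, map_zero, sub_zero, zero_sub] at h
  have h1 : twoDEta S X S.ξ x = 0 := by
    have h2 := congrArg (S.η x) h
    simpa [η_φ, S.η_ξ] using h2
  refine ⟨h1, ?_⟩
  rw [h1, zero_smul, add_zero, neg_add_eq_zero] at h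
  exact h

/-- The Reeb field of a normal structure is geodesic, because `dη(X, ξ) = 0` amounts to
`g(∇_ξ ξ, X) = 0`. -/
lemma IsLeviCivita.reeb_geodesic [T2Space M] (hD : IsLeviCivita S D) (hN : IsNormal S) (x : M) :
    D S.ξ x (S.ξ x) = 0 := by
  refine S.g_nondegenerate x _ fun v => ?_
  obtain ⟨X, hX, rfl⟩ := exists_smoothField_apply_eq v
  have hξ := S.smooth_ξ.mdifferentiableAt x
  -- `η(X) = g(X, ε ξ)`, so that the metric property computes the derivative of `η(X)`.
  have h := (hN.twoDEta_eq_zero_and_φ_mlieBracket_eq hX x).1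
  have hεξ : D (S.ε • S.ξ) x = S.ε • D S.ξ x :=
    D.isCovariantDerivativeOn.smul_const (s := Set.univ) S.ε hξ
  have hm := hD.metric X (S.ε • S.ξ) x (S.ξ x) (hX.mdifferentiableAt x)
    (hξ.smul_const_section)
  have hη : (fun y => S.g y (X y) ((S.ε • S.ξ) y)) = fun y => S.η y (X y) := by
    funext y
    rw [Pi.smul_apply, map_smul, η_eq, smul_eq_mul]
  have h1 : (fun y => S.η y (S.ξ y)) = fun _ => (1 : ℝ) := funext fun y => S.η_ξ y
  rw [hη, hεξ, Pi.smul_apply, map_smul, smul_apply, map_smul, smul_eq_mul, smul_eq_mul,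
    ← η_eq] at hm
  rw [twoDEta, h1, mvfderiv_const, hm, ← hD.torsion_free X S.ξ x (hX.mdifferentiableAt x) hξ,
    map_sub, hD.η_reeb, S.g_symm] at h
  simp only [zero_apply] at h
  have h2 : S.ε * S.g x (D S.ξ x (S.ξ x)) (X x) = 0 := by linarith
  have h3 : S.ε ≠ 0 := fun h0 => by have := S.ε_sq; simp [h0] at this
  exact (mul_eq_zero.1 h2).resolve_left h3

/-- For a normal structure, `∇ξ` commutes with `φ` on the contact planes: both identities are the
invariance `[ξ, φX] = φ[ξ, X]` paired with `φ X` and with `X`, the terms in `∇_ξ` being removed by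
the constancy of `g(φX, X)` and of `g(φX, φX) - g(X, X)`. -/
lemma IsLeviCivita.reeb_commute [T2Space M] (hD : IsLeviCivita S D) (hN : IsNormal S) {x : M}
    {v : TangentSpace (𝓡 3) x} (hv : S.η x v = 0) :
    S.g x (D S.ξ x (S.φ x v)) v = -S.g x (D S.ξ x v) (S.φ x v) ∧
      S.g x (D S.ξ x (S.φ x v)) (S.φ x v) = S.g x (D S.ξ x v) v := by
  -- Extending `v` as `φ² Y` makes the extension `X` a section of the contact distribution.
  obtain ⟨Y, hY, hYv⟩ := exists_smoothField_apply_eq (-v)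
  obtain ⟨X, hX, hXv, hηX⟩ : ∃ X : VField M, SmoothField X ∧ X x = v ∧ ∀ y, S.η y (X y) = 0 := by
    refine ⟨fun y => S.φ y (S.φ y (Y y)), (hY.φ S).φ S, ?_, fun y => η_φ S _⟩
    simp [hYv, S.φ_sq, hv]
  subst hXv
  have hφX := hX.φ S
  have h := (hN.twoDEta_eq_zero_and_φ_mlieBracket_eq hX x).2
  rw [← hD.torsion_free X S.ξ x (hX.mdifferentiableAt x) (S.smooth_ξ.mdifferentiableAt x),
    ← hD.torsion_free _ S.ξ x (hφX.mdifferentiableAt x) (S.smooth_ξ.mdifferentiableAt x)] at h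
  have e1 := congrArg (fun w => S.g x w (S.φ x (X x))) h
  have e2 := congrArg (fun w => S.g x w (X x)) h
  simp only [g_φ_φ S hv, g_φ_left S _ (X x), map_sub, sub_apply] at e1 e2
  have m1 := hD.g_add_g_eq_zero hφX hX (fun y => g_φ_self S (X y)) x (S.ξ x)
  have m2 := hD.metric _ _ x (S.ξ x) (hφX.mdifferentiableAt x) (hφX.mdifferentiableAt x)
  rw [show (fun y => S.g y (S.φ y (X y)) (S.φ y (X y))) = fun y => S.g y (X y) (X y) from
      funext fun y => g_φ_φ S (hηX y) _,
    hD.metric _ _ x (S.ξ x) (hX.mdifferentiableAt x) (hX.mdifferentiableAt x)] at m2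
  rw [S.g_symm x (X x), S.g_symm x (S.φ x (X x))] at m2
  rw [S.g_symm x (S.φ x (X x))] at m1
  constructor <;> linarith

/-- For a quasi-Sasakian structure, `∇_v ξ = -α φ v` for a unit vector `v` in the contact plane. -/
lemma IsLeviCivita.reeb_eq [T2Space M] (hD : IsLeviCivita S D) (hQ : IsQuasiSasakian S D) {x : M}
    {v : TangentSpace (𝓡 3) x} (hv : S.η x v = 0) (hg : S.g x v v = 1) :
    D S.ξ x v = -alpha S D x • S.φ x v := by
  obtain ⟨h1, h2⟩ := hD.reeb_commute hQ.normal hv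
  have hβ := hQ.beta_eq_zero x
  have hα : alpha S D x = 1 / 2 * LinearMap.trace ℝ (TangentSpace (𝓡 3) x)
    ((S.φ x).toLinearMap ∘ₗ (D S.ξ x).toLinearMap) := rfl
  rw [beta, trace_eq S hv hg] at hβ
  rw [trace_eq S hv hg] at hα
  simp only [ContinuousLinearMap.coe_coe, LinearMap.comp_apply, hD.reeb_geodesic hQ.normal,
    map_zero, g_φ_left S _ v, g_φ_φ S hv] at hα hβ
  rw [eq_adapted_expansion S hv hg (D S.ξ x v), hD.η_reeb,
    show S.g x (D S.ξ x v) v = 0 by linarith,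
    show S.g x (D S.ξ x v) (S.φ x v) = -alpha S D x by linarith]
  simp

end Reeb

/-! ### The Frenet-type equations of a Legendre curve -/

/-- The product rule for two fields along a curve whose inner product is locally constant. -/
lemma ProductRuleAt.eq_zero {S : AlmostContactPseudoMetric M} {D : Connection M} {υ : ℝ → M}
    {V W : FieldAlong υ} {t c : ℝ} (h : ProductRuleAt S D υ V W t)
    (hc : ∀ᶠ u in 𝓝 t, S.g (υ u) (V u) (W u) = c) :
    S.g (υ t) (covDerivAlong D υ V t) (W t) + S.g (υ t) (V t) (covDerivAlong D υ W t) = 0 :=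
  h.unique ((hasDerivAt_const t c).congr_of_eventuallyEq hc)

lemma SmoothAlong.smoothAlongAt {υ : ℝ → M} {I : Set ℝ} {V : FieldAlong υ} (hI : IsOpen I)
    (hV : SmoothAlong υ I V) {t : ℝ} (ht : t ∈ I) : SmoothAlongAt υ V t :=
  ContMDiffOn.contMDiffAt hV (hI.mem_nhds ht)

section Curve

variable {S : AlmostContactPseudoMetric M} {D : Connection M} {I : Set ℝ} {υ : ℝ → M}
  {t : ℝ}

lemma IsNonGeodesicLegendre.smoothAlongAt_velocity (hυ : IsNonGeodesicLegendre S D I υ)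
    (hI : IsOpen I) (ht : t ∈ I) : SmoothAlongAt υ (velocity υ) t :=
  QuasiSasakian.smoothAlongAt_velocity hI hυ.smooth ht

lemma IsNonGeodesicLegendre.smoothAlongAt_ξ (hυ : IsNonGeodesicLegendre S D I υ)
    (hI : IsOpen I) (ht : t ∈ I) : SmoothAlongAt υ (fun u => S.ξ (υ u)) t :=
  smoothAlongAt_comp (S.smooth_ξ _) (hυ.smoothAlongAt_velocity hI ht).curve

lemma IsConstantPoint.covDerivAlong_eq {P : FieldAlong υ} (hP : IsConstantPoint D I υ P)
    (ht : t ∈ I) :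
    covDerivAlong D υ P t = -velocity υ t :=
  (neg_eq_of_add_eq_zero_right (hP.deriv_eq_zero t ht)).symm

lemma IsConstantPoint.hasDerivAt_g_self {P : FieldAlong υ} (hP : IsConstantPoint D I υ P)
    (hD : IsLeviCivita S D) (hI : IsOpen I) (ht : t ∈ I) :
    HasDerivAt (fun u => S.g (υ u) (P u) (P u)) (-2 * S.g (υ t) (P t) (velocity υ t)) t := by
  have hPt := hP.smooth.smoothAlongAt hI ht
  refine (hD.productRuleAt hPt hPt : HasDerivAt _ _ _).congr_deriv ?_
  rw [hP.covDerivAlong_eq ht, map_neg, map_neg, neg_apply, S.g_symm _ (velocity υ t)]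
  ring

variable [T2Space M]

lemma IsNonGeodesicLegendre.smoothAlongAt_acceleration (hυ : IsNonGeodesicLegendre S D I υ)
    (hD : IsLeviCivita S D) (hI : IsOpen I) (ht : t ∈ I) :
    SmoothAlongAt υ (acceleration D υ) t :=
  hD.smoothAlongAt_covDerivAlong
    (Eventually.mono (p := (· ∈ I)) (hI.mem_nhds ht) fun _ hu => hυ.smoothAlongAt_velocity hI hu)
    (hυ.smoothAlongAt_velocity hI ht)

lemma IsNonGeodesicLegendre.contDiffAt_vartheta (hυ : IsNonGeodesicLegendre S D I υ)
    (hD : IsLeviCivita S D) (hI : IsOpen I) (ht : t ∈ I) :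
    ContDiffAt ℝ ∞ (vartheta S D υ) t :=
  contDiffAt_g (hυ.smoothAlongAt_acceleration hD hI ht)
    ((hυ.smoothAlongAt_velocity hI ht).φ S)

/-- `∇_T ξ = -α φT`. -/
lemma IsNonGeodesicLegendre.covDerivAlong_ξ (hυ : IsNonGeodesicLegendre S D I υ)
    (hD : IsLeviCivita S D) (hQ : IsQuasiSasakian S D) (hI : IsOpen I) (ht : t ∈ I) :
    covDerivAlong D υ (fun u => S.ξ (υ u)) t
      = -alpha S D (υ t) • S.φ (υ t) (velocity υ t) := by
  rw [covDerivAlong_comp D (S.smooth_ξ _) (hυ.smoothAlongAt_velocity hI ht).curve,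
    hD.reeb_eq hQ (hυ.legendre t ht) (hυ.unit_speed t ht)]

lemma IsNonGeodesicLegendre.contDiffAt_alpha (hυ : IsNonGeodesicLegendre S D I υ)
    (hD : IsLeviCivita S D) (hQ : IsQuasiSasakian S D) (hI : IsOpen I) (ht : t ∈ I) :
    ContDiffAt ℝ ∞ (fun u => alpha S D (υ u)) t := by
  have hI' : ∀ᶠ u in 𝓝 t, u ∈ I := hI.mem_nhds ht
  have h := contDiffAt_g (S := S) (hD.smoothAlongAt_covDerivAlong
    (hI'.mono fun _ hu => hυ.smoothAlongAt_ξ hI hu) (hυ.smoothAlongAt_velocity hI ht))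
    ((hυ.smoothAlongAt_velocity hI ht).φ S)
  refine h.neg.congr_of_eventuallyEq (hI'.mono fun u hu => ?_)
  simp only [hυ.covDerivAlong_ξ hD hQ hI hu, map_smul, smul_apply,
    g_φ_φ S (hυ.legendre u hu), hυ.unit_speed u hu]
  simp

/-- `∇_T T = ϑ φT`. -/
lemma IsNonGeodesicLegendre.acceleration_eq (hυ : IsNonGeodesicLegendre S D I υ)
    (hD : IsLeviCivita S D) (hQ : IsQuasiSasakian S D) (hI : IsOpen I) (ht : t ∈ I) :
    acceleration D υ t = vartheta S D υ t • S.φ (υ t) (velocity υ t) := by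
  have hI' : ∀ᶠ u in 𝓝 t, u ∈ I := hI.mem_nhds ht
  have hT := hυ.smoothAlongAt_velocity hI ht
  have h1 := (hD.productRuleAt hT hT).eq_zero (hI'.mono fun u hu => hυ.unit_speed u hu)
  have h2 := (hD.productRuleAt hT (hυ.smoothAlongAt_ξ hI ht)).eq_zero
    (hI'.mono fun u hu => by rw [g_ξ, hυ.legendre u hu, mul_zero])
  rw [S.g_symm _ (velocity υ t)] at h1
  rw [hυ.covDerivAlong_ξ hD hQ hI ht, map_smul, S.g_symm _ (velocity υ t), g_φ_self, smul_zero,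
    add_zero] at h2
  rw [eq_adapted_expansion S (hυ.legendre t ht) (hυ.unit_speed t ht) (acceleration D υ t),
    η_eq, acceleration, h2, show S.g (υ t) (covDerivAlong D υ (velocity υ) t) (velocity υ t) = 0 by
      linarith]
  simp [vartheta, acceleration]

lemma IsNonGeodesicLegendre.vartheta_ne_zero (hυ : IsNonGeodesicLegendre S D I υ)
    (hD : IsLeviCivita S D) (hQ : IsQuasiSasakian S D) (hI : IsOpen I) (ht : t ∈ I) :
    vartheta S D υ t ≠ 0 := by
  intro h
  have hκ := hυ.curvature_pos t ht
  rw [curvature, hυ.acceleration_eq hD hQ hI ht, h] at hκ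
  simp at hκ

/-- `∇_T φT = -ϑ T + ε α ξ`. -/
lemma IsNonGeodesicLegendre.covDerivAlong_φ_velocity (hυ : IsNonGeodesicLegendre S D I υ)
    (hD : IsLeviCivita S D) (hQ : IsQuasiSasakian S D) (hI : IsOpen I) (ht : t ∈ I) :
    covDerivAlong D υ (fun u => S.φ (υ u) (velocity υ u)) t
      = -vartheta S D υ t • velocity υ t + (S.ε * alpha S D (υ t)) • S.ξ (υ t) := by
  have hI' : ∀ᶠ u in 𝓝 t, u ∈ I := hI.mem_nhds ht
  have hT := hυ.smoothAlongAt_velocity hI ht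
  have hN := hT.φ S
  have hη := hυ.legendre t ht
  have hg := hυ.unit_speed t ht
  have h1 := (hD.productRuleAt hN hT).eq_zero (Eventually.of_forall fun u => g_φ_self S _)
  have h2 := (hD.productRuleAt hN hN).eq_zero
    (hI'.mono fun u hu => (g_φ_φ S (hυ.legendre u hu) _).trans (hυ.unit_speed u hu))
  have h3 := (hD.productRuleAt hN (hυ.smoothAlongAt_ξ hI ht)).eq_zero
    (Eventually.of_forall fun u => (by rw [g_ξ, η_φ, mul_zero]))
  rw [show covDerivAlong D υ (velocity υ) t = _ from hυ.acceleration_eq hD hQ hI ht, map_smul,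
    g_φ_φ S hη, hg, smul_eq_mul, mul_one] at h1
  rw [S.g_symm _ (S.φ _ _)] at h2
  rw [hυ.covDerivAlong_ξ hD hQ hI ht, map_smul, g_φ_φ S hη, hg, smul_eq_mul, mul_one] at h3
  rw [eq_adapted_expansion S hη hg (covDerivAlong D υ (fun u => S.φ (υ u) (velocity υ u)) t),
    η_eq, eq_neg_of_add_eq_zero_left h1, eq_neg_of_add_eq_zero_left h3, neg_neg,
    show S.g (υ t) (covDerivAlong D υ (fun u => S.φ (υ u) (velocity υ u)) t)
      (S.φ (υ t) (velocity υ t)) = 0 by linarith, zero_smul, add_zero]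

/-! ### Constant points -/

section ConstantPoint

variable {P : FieldAlong υ}

lemma IsConstantPoint.hasDerivAt_g_velocity (hP : IsConstantPoint D I υ P)
    (hυ : IsNonGeodesicLegendre S D I υ) (hD : IsLeviCivita S D) (hQ : IsQuasiSasakian S D)
    (hI : IsOpen I) (ht : t ∈ I) :
    HasDerivAt (fun u => S.g (υ u) (P u) (velocity υ u))
      (-1 + vartheta S D υ t * S.g (υ t) (P t) (S.φ (υ t) (velocity υ t))) t := by
  refine (hD.productRuleAt (hP.smooth.smoothAlongAt hI ht)
    (hυ.smoothAlongAt_velocity hI ht) : HasDerivAt _ _ _).congr_deriv ?_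
  rw [hP.covDerivAlong_eq ht,
    show covDerivAlong D υ (velocity υ) t = _ from hυ.acceleration_eq hD hQ hI ht, map_neg,
    neg_apply, hυ.unit_speed t ht, map_smul, smul_eq_mul]

lemma IsConstantPoint.hasDerivAt_g_φ_velocity (hP : IsConstantPoint D I υ P)
    (hυ : IsNonGeodesicLegendre S D I υ) (hD : IsLeviCivita S D) (hQ : IsQuasiSasakian S D)
    (hI : IsOpen I) (ht : t ∈ I) :
    HasDerivAt (fun u => S.g (υ u) (P u) (S.φ (υ u) (velocity υ u)))
      (-vartheta S D υ t * S.g (υ t) (P t) (velocity υ t)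
        + S.ε * alpha S D (υ t) * S.g (υ t) (P t) (S.ξ (υ t))) t := by
  refine (hD.productRuleAt (hP.smooth.smoothAlongAt hI ht)
    ((hυ.smoothAlongAt_velocity hI ht).φ S) : HasDerivAt _ _ _).congr_deriv ?_
  rw [hP.covDerivAlong_eq ht, hυ.covDerivAlong_φ_velocity hD hQ hI ht, map_neg, neg_apply,
    S.g_symm _ (velocity υ t), g_φ_self, map_add, map_smul, map_smul]
  simp only [smul_eq_mul]
  ring

lemma IsConstantPoint.hasDerivAt_g_ξ (hP : IsConstantPoint D I υ P)
    (hυ : IsNonGeodesicLegendre S D I υ) (hD : IsLeviCivita S D) (hQ : IsQuasiSasakian S D)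
    (hI : IsOpen I) (ht : t ∈ I) :
    HasDerivAt (fun u => S.g (υ u) (P u) (S.ξ (υ u)))
      (-alpha S D (υ t) * S.g (υ t) (P t) (S.φ (υ t) (velocity υ t))) t := by
  refine (hD.productRuleAt (hP.smooth.smoothAlongAt hI ht)
    (hυ.smoothAlongAt_ξ hI ht) : HasDerivAt _ _ _).congr_deriv ?_
  rw [hP.covDerivAlong_eq ht, hυ.covDerivAlong_ξ hD hQ hI ht, map_neg, neg_apply, g_ξ,
    hυ.legendre t ht, map_smul, smul_eq_mul]
  ring

end ConstantPoint

/-- Along a connected curve the function `α` has constant sign `σ`. -/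
lemma IsNonGeodesicLegendre.exists_sign_alpha (hυ : IsNonGeodesicLegendre S D I υ)
    (hD : IsLeviCivita S D) (hQ : IsQuasiSasakian S D) (hI : IsOpen I) (hI' : I.OrdConnected)
    (hα : ∀ s ∈ I, alpha S D (υ s) ≠ 0) :
    ∃ σ : ℝ, σ ^ 2 = 1 ∧ ∀ s ∈ I, |alpha S D (υ s)| = σ * alpha S D (υ s) := by
  have hc : ContinuousOn (fun u => alpha S D (υ u)) I := fun s hs =>
    (hυ.contDiffAt_alpha hD hQ hI hs).continuousAt.continuousWithinAt
  rcases hI'.isPreconnected.eq_or_eq_neg_of_sq_eq hc.abs hc (fun s _ => by simp)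
    (fun {s} hs => hα s hs) with h | h
  · exact ⟨1, by norm_num, fun s hs => by rw [one_mul]; exact h hs⟩
  · exact ⟨-1, by norm_num, fun s hs => by rw [neg_one_mul]; exact h hs⟩

/-- If the position vector of a constant point is orthogonal to the curve, then it is
`ϑ⁻¹ φT - ϑ' / (ϑ² α) ξ`, and the equation for its `ξ`-component is the differential equation
for `ϑ`. -/
lemma IsConstantPoint.deriv_eq_of_orthogonal {P : FieldAlong υ} (hP : IsConstantPoint D I υ P)
    (hυ : IsNonGeodesicLegendre S D I υ) (hD : IsLeviCivita S D) (hQ : IsQuasiSasakian S D)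
    (hI : IsOpen I) (hI' : I.OrdConnected) (hα : ∀ s ∈ I, alpha S D (υ s) ≠ 0)
    (ho : ∀ s ∈ I, S.g (υ s) (P s) (velocity υ s) = 0) :
    ∀ s ∈ I, deriv (fun t => deriv (vartheta S D υ) t /
        (vartheta S D υ t ^ 2 * |alpha S D (υ t)|)) s
      - S.ε * |alpha S D (υ s)| / vartheta S D υ s = 0 := by
  obtain ⟨σ, hσ, hσα⟩ := hυ.exists_sign_alpha hD hQ hI hI' hα
  have hev : ∀ s ∈ I, ∀ᶠ u in 𝓝 s, u ∈ I := fun s hs => hI.mem_nhds hs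
  have hb : ∀ s ∈ I, S.g (υ s) (P s) (S.φ (υ s) (velocity υ s)) = (vartheta S D υ s)⁻¹ := by
    intro s hs
    have h := (hP.hasDerivAt_g_velocity hυ hD hQ hI hs).unique
      ((hasDerivAt_const s (0 : ℝ)).congr_of_eventuallyEq ((hev s hs).mono ho))
    exact eq_inv_of_mul_eq_one_right (by linarith)
  have hq : ∀ s ∈ I, deriv (vartheta S D υ) s / (vartheta S D υ s ^ 2 * |alpha S D (υ s)|)
      = -(S.ε * σ) * S.g (υ s) (P s) (S.ξ (υ s)) := by
    intro s hs
    have hϑ := hυ.vartheta_ne_zero hD hQ hI hs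
    have h := (hP.hasDerivAt_g_φ_velocity hυ hD hQ hI hs).unique
      ((((hυ.contDiffAt_vartheta hD hI hs).differentiableAt (by simp)).hasDerivAt.inv
        hϑ).congr_of_eventuallyEq ((hev s hs).mono hb))
    rw [ho s hs, mul_zero, zero_add] at h
    have hαs := hα s hs
    have hσ0 : σ ≠ 0 := fun h0 => by simp [h0] at hσ
    have h' : deriv (vartheta S D υ) s / vartheta S D υ s ^ 2
        = -(S.ε * alpha S D (υ s) * S.g (υ s) (P s) (S.ξ (υ s))) := by rw [h]; ring
    rw [← div_div, h', hσα s hs, div_eq_iff (mul_ne_zero hσ0 hαs)]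
    linear_combination (S.ε * alpha S D (υ s) * S.g (υ s) (P s) (S.ξ (υ s))) * hσ
  intro s hs
  have h := ((hP.hasDerivAt_g_ξ hυ hD hQ hI hs).const_mul (-(S.ε * σ))).congr_of_eventuallyEq
    ((hev s hs).mono hq)
  rw [h.deriv, hb s hs, hσα s hs, div_eq_mul_inv]
  ring

/-! ### The constant point determined by the differential equation -/

/-- A function with vanishing derivative on an interval is constant there. -/
lemma eq_of_hasDerivAt_zero {f : ℝ → ℝ} (hI : IsOpen I) (hI' : I.OrdConnected)
    (hf : ∀ s ∈ I, HasDerivAt f 0 s) {a b : ℝ} (ha : a ∈ I) (hb : b ∈ I) : f a = f b :=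
  hI.is_const_of_deriv_eq_zero hI'.isPreconnected
    (fun s hs => (hf s hs).differentiableAt.differentiableWithinAt)
    (fun s hs => (hf s hs).deriv) ha hb

/-- A solution of the linear equation `f' = τ ρ f` is an exponential. -/
lemma eq_exp_integral {f ρ : ℝ → ℝ} {τ a : ℝ} (hI : IsOpen I) (hI' : I.OrdConnected) (ha : a ∈ I)
    (hρ : ContinuousOn ρ I) (hf : ∀ s ∈ I, HasDerivAt f (τ * ρ s * f s) s) :
    ∀ s ∈ I, f s = f a * Real.exp (τ * ∫ t in a..s, ρ t) := by
  have hF : ∀ s ∈ I, HasDerivAt (fun s => ∫ t in a..s, ρ t) (ρ s) s := fun s hs =>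
    intervalIntegral.integral_hasDerivAt_right
      ((hρ.mono (hI'.uIcc_subset ha hs)).intervalIntegrable)
      (hρ.stronglyMeasurableAtFilter hI s hs) (hρ.continuousAt (hI.mem_nhds hs))
  intro s hs
  have h := eq_of_hasDerivAt_zero (f := fun s => f s * Real.exp (-(τ * ∫ t in a..s, ρ t))) hI hI'
    (fun u hu => ((hf u hu).mul ((hF u hu).const_mul τ).neg.exp).congr_deriv (by ring)) hs ha
  simp only [intervalIntegral.integral_same, mul_zero, neg_zero, Real.exp_zero, mul_one] at h
  rw [← h, mul_assoc, ← Real.exp_add]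
  simp

/-- If `ϑ` solves the differential equation, then `ϑ⁻¹ φT - σ q ξ` is a constant point, where
`q = ϑ' / (ϑ² |α|)` and `σ` is the sign of `α`. -/
lemma IsNonGeodesicLegendre.isConstantPoint (hυ : IsNonGeodesicLegendre S D I υ)
    (hD : IsLeviCivita S D) (hQ : IsQuasiSasakian S D)
    (hI : IsOpen I) (hα : ∀ s ∈ I, alpha S D (υ s) ≠ 0) {σ : ℝ} (hσ : σ ^ 2 = 1)
    (hσα : ∀ s ∈ I, |alpha S D (υ s)| = σ * alpha S D (υ s)) {q : ℝ → ℝ}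
    (hq : ∀ s ∈ I, q s = deriv (vartheta S D υ) s / (vartheta S D υ s ^ 2 * |alpha S D (υ s)|))
    (hq' : ∀ s ∈ I, deriv q s = S.ε * |alpha S D (υ s)| / vartheta S D υ s)
    (hqs : ∀ s ∈ I, ContDiffAt ℝ ∞ q s) :
    IsConstantPoint D I υ fun u => (vartheta S D υ u)⁻¹ • S.φ (υ u) (velocity υ u)
      + (-σ * q u) • S.ξ (υ u) := by
  have hb : ∀ s ∈ I, ContDiffAt ℝ ∞ (fun u => (vartheta S D υ u)⁻¹) s := fun s hs =>
    (hυ.contDiffAt_vartheta hD hI hs).inv (hυ.vartheta_ne_zero hD hQ hI hs)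
  have hc : ∀ s ∈ I, ContDiffAt ℝ ∞ (fun u => -σ * q u) s := fun s hs =>
    contDiffAt_const.mul (hqs s hs)
  have hN := fun s hs => (hυ.smoothAlongAt_velocity hI (t := s) hs).φ S
  have hξ := fun s hs => hυ.smoothAlongAt_ξ hI (t := s) hs
  refine ⟨fun s hs => (((hN s hs).smul (hb s hs)).add
    ((hξ s hs).smul (hc s hs))).contMDiffWithinAt, fun s hs => ?_⟩
  have hϑ := hυ.vartheta_ne_zero hD hQ hI hs
  have hαs := hα s hs
  have hσ0 : σ ≠ 0 := fun h0 => by simp [h0] at hσ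
  have hd : deriv (fun u => (vartheta S D υ u)⁻¹) s
      = -deriv (vartheta S D υ) s / vartheta S D υ s ^ 2 :=
    (((hυ.contDiffAt_vartheta hD hI hs).differentiableAt (by simp)).hasDerivAt.inv hϑ).deriv
  rw [covDerivAlong_add D ((hN s hs).smul (hb s hs)) ((hξ s hs).smul (hc s hs)),
    covDerivAlong_smul D (hb s hs) (hN s hs), covDerivAlong_smul D (hc s hs) (hξ s hs),
    hυ.covDerivAlong_φ_velocity hD hQ hI hs, hυ.covDerivAlong_ξ hD hQ hI hs, hd,
    deriv_const_mul _ ((hqs s hs).differentiableAt (by simp)), hq' s hs, hq s hs, hσα s hs]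
  match_scalars
  · field_simp
    ring
  · field_simp
    ring
  · field_simp
    linear_combination -(S.ε * alpha S D (υ s)) * hσ

end Curve

/-! ### The three equivalent conditions -/

section Equivalence

variable {S : AlmostContactPseudoMetric M} {D : Connection M} {I : Set ℝ} {υ : ℝ → M}

/-- The centre of a sphere containing the curve is the centre of all its osculating spheres. -/
lemma IsSpherical.osculatingCentresConstant (h : IsSpherical S D I υ) (hD : IsLeviCivita S D)
    (hI : IsOpen I) (hI' : I.OrdConnected) : OsculatingCentresConstant S D I υ := by
  obtain ⟨P, hP, r, hr, hPr⟩ := h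
  -- By connectedness the curve lies on one of the two spheres `g(c - υ, c - υ) = ± r²`.
  obtain ⟨δ, hδ, hδP⟩ : ∃ δ : ℝ, (δ = 1 ∨ δ = -1) ∧
      ∀ t ∈ I, S.g (υ t) (P t) (P t) - δ * r ^ 2 = 0 := by
    have hc : ContinuousOn (fun t => S.g (υ t) (P t) (P t)) I := fun s hs =>
      (hP.hasDerivAt_g_self hD hI hs).continuousAt.continuousWithinAt
    rcases hI'.isPreconnected.eq_or_eq_neg_of_sq_eq hc
      (continuousOn_const (c := r ^ 2)) (fun t ht => by
        rcases hPr t ht with h | h <;> simp [h]) (fun {_} _ => (pow_pos hr 2).ne') with h | h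
    · exact ⟨1, Or.inl rfl, fun t ht => by rw [one_mul, sub_eq_zero]; exact h ht⟩
    · exact ⟨-1, Or.inr rfl, fun t ht => by rw [neg_one_mul, sub_eq_zero]; exact h ht⟩
  refine ⟨P, fun s hs => ⟨P, hP, rfl, r, δ, hr.le, hδ, fun j _ => ?_⟩, hP⟩
  have he : (fun t => S.g (υ t) (P t) (P t) - δ * r ^ 2) =ᶠ[𝓝 s] fun _ => 0 :=
    Eventually.mono (p := (· ∈ I)) (hI.mem_nhds hs) hδP
  rw [he.iteratedDeriv_eq]
  simp

/-- The first-order osculation condition says that the position vector of the centre is orthogonal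
to the curve. -/
lemma IsOsculatingCentre.orthogonal {s : ℝ} {v : TangentSpace (𝓡 3) (υ s)}
    (h : IsOsculatingCentre S D I υ s v) (hD : IsLeviCivita S D) (hI : IsOpen I) (hs : s ∈ I) :
    S.g (υ s) v (velocity υ s) = 0 := by
  obtain ⟨P, hP, rfl, r, δ, -, -, hj⟩ := h
  have h1 := hj 1 (by norm_num)
  rw [iteratedDeriv_one, ((hP.hasDerivAt_g_self hD hI hs).sub_const _).deriv] at h1
  linarith

variable [T2Space M]

/-- If `ϑ⁻² + ε q²` vanishes at one point, where `q = ϑ' / (ϑ² |α|)` satisfies the differential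
equation, then `ξ` is timelike and `ϑ` is one of the two excluded exponentials. -/
lemma IsNonGeodesicLegendre.exp_of_null (hυ : IsNonGeodesicLegendre S D I υ)
    (hD : IsLeviCivita S D) (hQ : IsQuasiSasakian S D) (hI : IsOpen I) (hI' : I.OrdConnected)
    {s₀ : ℝ} (hs₀ : s₀ ∈ I) (hα : ∀ s ∈ I, alpha S D (υ s) ≠ 0)
    (hnull : ∀ s ∈ I, (vartheta S D υ s)⁻¹ ^ 2 + S.ε *
      (deriv (vartheta S D υ) s / (vartheta S D υ s ^ 2 * |alpha S D (υ s)|)) ^ 2 = 0) :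
    S.ε = -1 ∧ ((∀ s ∈ I, vartheta S D υ s = vartheta S D υ s₀ *
          Real.exp (∫ t in s₀..s, |alpha S D (υ t)|)) ∨
      (∀ s ∈ I, vartheta S D υ s = vartheta S D υ s₀ *
          Real.exp (-∫ t in s₀..s, |alpha S D (υ t)|))) := by
  have hϑ := fun s hs => hυ.vartheta_ne_zero hD hQ hI (t := s) hs
  have hε : S.ε = -1 := by
    rcases mul_self_eq_one_iff.1 ((sq _).symm.trans S.ε_sq) with h | h
    · have h1 := hnull s₀ hs₀
      have h2 := inv_ne_zero (hϑ s₀ hs₀)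
      rw [h] at h1
      exact absurd h1 (by positivity)
    · exact h
  refine ⟨hε, ?_⟩
  have hρ : ContinuousOn (fun u => |alpha S D (υ u)|) I := fun s hs =>
    (hυ.contDiffAt_alpha hD hQ hI hs).continuousAt.abs.continuousWithinAt
  have hcϑ : ContinuousOn (vartheta S D υ) I := fun s hs =>
    (hυ.contDiffAt_vartheta hD hI hs).continuousAt.continuousWithinAt
  have hcϑ' : ContinuousOn (deriv (vartheta S D υ)) I := fun s hs =>
    ((hυ.contDiffAt_vartheta hD hI hs).fderiv_right (m := ∞) (by simp)
      |>.clm_apply contDiffAt_const).continuousAt.continuousWithinAt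
  have hϑ' := fun s hs => ((hυ.contDiffAt_vartheta hD hI (t := s) hs).differentiableAt
    (by simp)).hasDerivAt
  have hsq : ∀ s ∈ I, deriv (vartheta S D υ) s ^ 2
      = (|alpha S D (υ s)| * vartheta S D υ s) ^ 2 := by
    intro s hs
    have h := hnull s hs
    have h1 := hϑ s hs
    have h2 := abs_ne_zero.2 (hα s hs)
    rw [hε] at h
    field_simp at h
    linear_combination -h
  rcases hI'.isPreconnected.eq_or_eq_neg_of_sq_eq hcϑ' (hρ.mul hcϑ) (fun s hs => hsq s hs)
    (fun {s} hs => mul_ne_zero (abs_ne_zero.2 (hα s hs)) (hϑ s hs)) with h | h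
  · left
    have := eq_exp_integral (τ := 1) hI hI' hs₀ hρ fun s hs => (hϑ' s hs).congr_deriv (by
      rw [h hs, one_mul]; rfl)
    simpa using this
  · right
    have := eq_exp_integral (τ := -1) hI hI' hs₀ hρ fun s hs => (hϑ' s hs).congr_deriv (by
      rw [h hs, neg_one_mul, neg_mul]; rfl)
    simpa using this

/-- A solution `ϑ` of the differential equation which is not one of the excluded exponentials
belongs to a spherical curve. -/
lemma IsNonGeodesicLegendre.isSpherical (hυ : IsNonGeodesicLegendre S D I υ)
    (hD : IsLeviCivita S D) (hQ : IsQuasiSasakian S D) (hI : IsOpen I) (hI' : I.OrdConnected)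
    {s₀ : ℝ} (hs₀ : s₀ ∈ I) (hα : ∀ s ∈ I, alpha S D (υ s) ≠ 0)
    (htimelike : S.ε = -1 →
      (¬ ∀ s ∈ I, vartheta S D υ s = vartheta S D υ s₀ *
          Real.exp (∫ t in s₀..s, |alpha S D (υ t)|)) ∧
      (¬ ∀ s ∈ I, vartheta S D υ s = vartheta S D υ s₀ *
          Real.exp (-∫ t in s₀..s, |alpha S D (υ t)|)))
    (hode : ∀ s ∈ I, deriv (fun t => deriv (vartheta S D υ) t /
        (vartheta S D υ t ^ 2 * |alpha S D (υ t)|)) s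
      - S.ε * |alpha S D (υ s)| / vartheta S D υ s = 0) :
    IsSpherical S D I υ := by
  obtain ⟨σ, hσ, hσα⟩ := hυ.exists_sign_alpha hD hQ hI hI' hα
  set q : ℝ → ℝ := fun t => deriv (vartheta S D υ) t /
    (vartheta S D υ t ^ 2 * |alpha S D (υ t)|) with hq
  have hqs : ∀ s ∈ I, ContDiffAt ℝ ∞ q s := fun s hs => by
    have hϑ := hυ.contDiffAt_vartheta hD hI hs
    have hϑ' : ContDiffAt ℝ ∞ (deriv (vartheta S D υ)) s :=
      (hϑ.fderiv_right (m := ∞) (by simp)).clm_apply contDiffAt_const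
    exact hϑ'.div ((hϑ.pow 2).mul ((hυ.contDiffAt_alpha hD hQ hI hs).abs (hα s hs)))
      (mul_ne_zero (pow_ne_zero 2 (hυ.vartheta_ne_zero hD hQ hI hs)) (abs_ne_zero.2 (hα s hs)))
  have hP := hυ.isConstantPoint hD hQ hI hα hσ hσα (q := q) (fun s _ => rfl)
    (fun s hs => sub_eq_zero.1 (hode s hs)) hqs
  have hgP : ∀ s ∈ I, S.g (υ s) ((vartheta S D υ s)⁻¹ • S.φ (υ s) (velocity υ s)
        + (-σ * q s) • S.ξ (υ s)) ((vartheta S D υ s)⁻¹ • S.φ (υ s) (velocity υ s)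
        + (-σ * q s) • S.ξ (υ s)) = (vartheta S D υ s)⁻¹ ^ 2 + S.ε * q s ^ 2 := by
    intro s hs
    simp only [map_add, map_smul, add_apply, smul_apply, g_φ_φ S (hυ.legendre s hs),
      hυ.unit_speed s hs, g_ξ, η_φ, S.η_ξ, S.g_symm _ (S.ξ (υ s)) (S.φ _ _), smul_eq_mul]
    linear_combination (S.ε * q s ^ 2) * hσ
  -- The squared length `ϑ⁻² + ε q²` of the position vector is a constant `K`.
  obtain ⟨K, hK⟩ : ∃ K, ∀ s ∈ I, (vartheta S D υ s)⁻¹ ^ 2 + S.ε * q s ^ 2 = K := by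
    refine ⟨(vartheta S D υ s₀)⁻¹ ^ 2 + S.ε * q s₀ ^ 2, fun s hs => ?_⟩
    rw [← hgP s hs, ← hgP s₀ hs₀]
    refine eq_of_hasDerivAt_zero hI hI' (fun u hu => (hP.hasDerivAt_g_self hD hI hu).congr_deriv ?_)
      hs hs₀
    simp [g_φ_self, S.g_symm _ (S.ξ (υ u)), g_ξ, hυ.legendre u hu]
  have hK0 : K ≠ 0 := by
    rintro rfl
    obtain ⟨hε, h | h⟩ := hυ.exp_of_null hD hQ hI hI' hs₀ hα hK
    · exact (htimelike hε).1 h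
    · exact (htimelike hε).2 h
  refine ⟨_, hP, √|K|, Real.sqrt_pos.2 (abs_pos.2 hK0), fun s hs => ?_⟩
  rw [hgP s hs, hK s hs, Real.sq_sqrt (abs_nonneg K)]
  rcases abs_choice K with h | h <;> simp [h]

end Equivalence

end QuasiSasakian

end

theorem mainTheorem1 {M : Type*} [TopologicalSpace M] [T2Space M] [ParacompactSpace M]
    [ChartedSpace QuasiSasakian.E3 M] [IsManifold (𝓡 3) ∞ M]
    (S : QuasiSasakian.AlmostContactPseudoMetric M) (D : QuasiSasakian.Connection M)
    (hD : QuasiSasakian.IsLeviCivita S D) (hQ : QuasiSasakian.IsQuasiSasakian S D)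
    (I : Set ℝ) (hI : IsOpen I) (hI' : I.OrdConnected) (s₀ : ℝ) (hs₀ : s₀ ∈ I)
    (υ : ℝ → M) (hυ : QuasiSasakian.IsNonGeodesicLegendre S D I υ)
    (hα : ∀ s ∈ I, QuasiSasakian.alpha S D (υ s) ≠ 0)
    (hspacelike : S.ε = 1 → ¬ ∃ k : ℝ, ∀ s ∈ I, QuasiSasakian.vartheta S D υ s = k)
    (htimelike : S.ε = -1 →
      (¬ ∀ s ∈ I, QuasiSasakian.vartheta S D υ s = QuasiSasakian.vartheta S D υ s₀ *
          Real.exp (∫ t in s₀..s, |QuasiSasakian.alpha S D (υ t)|)) ∧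
      (¬ ∀ s ∈ I, QuasiSasakian.vartheta S D υ s = QuasiSasakian.vartheta S D υ s₀ *
          Real.exp (-∫ t in s₀..s, |QuasiSasakian.alpha S D (υ t)|))) :
    List.TFAE
      [QuasiSasakian.IsSpherical S D I υ,
       QuasiSasakian.OsculatingCentresConstant S D I υ,
       ∀ s ∈ I,
        deriv (fun t => deriv (QuasiSasakian.vartheta S D υ) t /
            (QuasiSasakian.vartheta S D υ t ^ 2 * |QuasiSasakian.alpha S D (υ t)|)) s
          - S.ε * |QuasiSasakian.alpha S D (υ s)| / QuasiSasakian.vartheta S D υ s = 0] := by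
  tfae_have 1 → 2 := fun h => h.osculatingCentresConstant hD hI hI'
  tfae_have 2 → 3 := fun ⟨_, hC, hP⟩ => hP.deriv_eq_of_orthogonal hυ hD hQ hI hI' hα
    fun s hs => (hC s hs).orthogonal hD hI hs
  tfae_have 3 → 1 := hυ.isSpherical hD hQ hI hI' hs₀ hα htimelike
  tfae_finish
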